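/- Let $K$ be a field, let $q\in K$ be nonzero and not a root of unity, and let $k,n\ge 0$ be integers with $n=2k$. Let $\mathcal O_q(M(k,n))$ be the algebra of $k\times n$ quantum matrices, that is, the $K$-algebra generated by $x_{ij}$ ($1\le i\le k$, $1\le j\le n$) subject to the relations $$x_{ij}x_{il}=q\,x_{il}x_{ij}\ (j<l),\qquad x_{ij}x_{hj}=q\,x_{hj}x_{ij}\ (i<h),$$ $$x_{ij}x_{hl}=x_{hl}x_{ij}\ (h<i,\ j<l),\qquad x_{ij}x_{hl}-x_{hl}x_{ij}=(q-q^{-1})\,x_{il}x_{hj}\ (i<h,\ j<l).$$ For a $k$-element subset $J=\{j_1<\dots<j_k\}$ of $\{1,\dots,n\}$, let $$[J]=\sum_{\sigma\in S_k}(-q)^{l(\sigma)}x_{1j_{\sigma(1)}}\cdots x_{kj_{\sigma(k)}}$$ be the corresponding quantum Plücker coordinate, where $l(\sigma)$ is the number of inversions of $\sigma$. Let $\mathcal O_q(G(k,n))$, the quantum grassmannian, be the $K$-subalgebra of $\mathcal O_q(M(k,n))$ generated by all the $[J]$. Then there is a $K$-algebra automorphism $\tau$ of $\mathcal O_q(G(k,n))$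 (the diagram automorphism) such that $$\tau([I])=[\,w_0(\widehat I\,)\,]$$ for every $k$-element subset $I$ of $\{1,\dots,n\}$, where $\widehat I$ is the complement of $I$ in $\{1,\dots,n\}$ and $w_0$ is the longest element of the symmetric group on $\{1,\dots,n\}$, $w_0(i)=n+1-i$. -/

import Mathlib

/-- The defining relations of the algebra of `m × n` quantum matrices with parameter `q`, imposed on
the free `K`-algebra on generators indexed by `Fin m × Fin n`. -/
inductive QuantumMatrixRel {K : Type*} [Field K] (q : K) (m n : ℕ) :
    FreeAlgebra K (Fin m × Fin n) → FreeAlgebra K (Fin m × Fin n) → Prop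
  | row (i : Fin m) (j l : Fin n) (hjl : j < l) :
      QuantumMatrixRel q m n
        (FreeAlgebra.ι K (i, j) * FreeAlgebra.ι K (i, l))
        (q • (FreeAlgebra.ι K (i, l) * FreeAlgebra.ι K (i, j)))
  | col (i k : Fin m) (j : Fin n) (hik : i < k) :
      QuantumMatrixRel q m n
        (FreeAlgebra.ι K (i, j) * FreeAlgebra.ι K (k, j))
        (q • (FreeAlgebra.ι K (k, j) * FreeAlgebra.ι K (i, j)))
  | anti (i k : Fin m) (j l : Fin n) (hki : k < i) (hjl : j < l) :
      QuantumMatrixRel q m n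
        (FreeAlgebra.ι K (i, j) * FreeAlgebra.ι K (k, l))
        (FreeAlgebra.ι K (k, l) * FreeAlgebra.ι K (i, j))
  | diag (i k : Fin m) (j l : Fin n) (hik : i < k) (hjl : j < l) :
      QuantumMatrixRel q m n
        (FreeAlgebra.ι K (i, j) * FreeAlgebra.ι K (k, l)
          - FreeAlgebra.ι K (k, l) * FreeAlgebra.ι K (i, j))
        ((q - q⁻¹) • (FreeAlgebra.ι K (i, l) * FreeAlgebra.ι K (k, j)))

/-- The algebra `O_q(M(m,n))` of `m × n` quantum matrices over `K`. -/
abbrev QuantumMatrix {K : Type*} [Field K] (q : K) (m n : ℕ) : Type _ :=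
  RingQuot (QuantumMatrixRel q m n)

/-- The matrix `(x_{ij})` of canonical generators of `O_q(M(m,n))`. -/
noncomputable def QuantumMatrix.gen {K : Type*} [Field K] (q : K) (m n : ℕ) :
    Matrix (Fin m) (Fin n) (QuantumMatrix q m n) :=
  fun i j => RingQuot.mkAlgHom K (QuantumMatrixRel q m n) (FreeAlgebra.ι K (i, j))

/-- The length `l(σ)` of a permutation of `{1, …, t}`: its number of inversions. -/
def permLength {t : ℕ} (σ : Equiv.Perm (Fin t)) : ℕ :=
  (Finset.univ.filter fun p : Fin t × Fin t => p.1 < p.2 ∧ σ p.2 < σ p.1).card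

/-- The expression `∑_σ (-q)^{l(σ)} x_{1σ(1)} ⋯ x_{tσ(t)}` (ordered products) for a square matrix `x`
with entries in a not necessarily commutative `K`-algebra. -/
noncomputable def quantumDet {K : Type*} [Field K] (q : K) {A : Type*} [Ring A] [Algebra K A] {t : ℕ}
    (x : Matrix (Fin t) (Fin t) A) : A :=
  ∑ σ : Equiv.Perm (Fin t), (-q) ^ permLength σ • (List.ofFn fun i => x i (σ i)).prod

/-- The quantum minor `[I ∣ J]` of `O_q(M(m,n))`, for `I` and `J` of size `t`: the quantum determinant
of the submatrix with rows `I` and columns `J`, both listed in increasing order. -/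
noncomputable def quantumMinor {K : Type*} [Field K] (q : K) (m n : ℕ) {t : ℕ}
    (I : Finset (Fin m)) (J : Finset (Fin n)) (hI : I.card = t) (hJ : J.card = t) :
    QuantumMatrix q m n :=
  quantumDet q ((QuantumMatrix.gen q m n).submatrix (I.orderEmbOfFin hI) (J.orderEmbOfFin hJ))

/-- The quantum grassmannian `O_q(G(k,n))`: the subalgebra of `O_q(M(k,n))` generated by the `k × k`
quantum minors. A set of `k` rows is necessarily the set of all rows. -/
noncomputable def quantumGrassmannian {K : Type*} [Field K] (q : K) (k n : ℕ) :
    Subalgebra K (QuantumMatrix q k n) :=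
  Algebra.adjoin K {a | ∃ (J : Finset (Fin n)) (hJ : J.card = k),
    a = quantumMinor q k n Finset.univ J (Finset.card_fin k) hJ}

/-- The quantum Plücker coordinate `[J] = [1, …, k ∣ J]`, as an element of `O_q(G(k,n))`. -/
noncomputable def quantumPlucker {K : Type*} [Field K] (q : K) (k n : ℕ)
    (J : Finset (Fin n)) (hJ : J.card = k) : quantumGrassmannian q k n :=
  ⟨quantumMinor q k n Finset.univ J (Finset.card_fin k) hJ,
    Algebra.subset_adjoin ⟨J, hJ, rfl⟩⟩

/-- The longest element `w₀` of the symmetric group: it reverses the order of `{1, …, n}`. -/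
def longestPerm (n : ℕ) : Equiv.Perm (Fin n) := Fin.revPerm

/-- The set `w₀(Iᶜ)`, where `Iᶜ` is the complement of `I` in `{1, …, n}`. -/
def revCompl {n : ℕ} (I : Finset (Fin n)) : Finset (Fin n) :=
  Iᶜ.map (longestPerm n).toEmbedding

theorem card_revCompl {k n : ℕ} (hn : n = 2 * k) {I : Finset (Fin n)} (hI : I.card = k) :
    (revCompl I).card = k := by
  rw [revCompl, Finset.card_map, Finset.card_compl, Fintype.card_fin, hI]
  omega

/-! Place the `k × n` quantum matrix as the first `k` rows of the generic `n × n` quantum matrix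
`x`, with `n = 2k`. Two anti-homomorphisms of the square algebra are composed: the antipode
multiplied by the quantum determinant `d`, which sends `x` to its adjugate, and reflection in the
antidiagonal. The first sends a `k`-minor to `d ^ (k - 1)` times a signed complementary minor (the
quantum Jacobi identity, `IsQuantum.unop_rowMinor_qadj`); the second interchanges and reverses rows
and columns. The complement of the first `k` rows, reversed, is again the first `k` rows, so for `k
≥ 1` the composite endomorphism sends `[J]` to a scalar times `d ^ (k - 1) [w₀(Jᶜ)]`.

Two defects remain. The scalar depends on `J` only through `(-q) ^ (-∑ J)`, and is made constant by
rescaling column `j` by `(-q) ^ j`. The remaining factor is a central nonzero `b`. It is removed by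
homogeneity: scaling one row by a polynomial variable `X` gives a homomorphism with `[J] ↦ [w₀(Jᶜ)]
b X`. Applied to a relation among the `[J]`, it yields the transformed relation with `b X` in place
of `X`. As the algebra is a domain, `X ↦ b X` is injective on polynomials, so `b` may be dropped and
`X` set to `1`. Hence the substitution `J ↦ w₀(Jᶜ)` preserves relations; being an involution, it
gives an automorphism.

The supporting theory has three pillars. Minors are `q`-alternating and invariant under
transposition, the latter by dividing by the Poincaré polynomial of the symmetric group at `q ^ 2`,
nonzero because `q` is not a root of unity; Laplace expansions and a two-sided adjugate follow. The
adjugate satisfies the quantum relations over the opposite algebra, because these relations say that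
`x ⊗ x` commutes with a Hecke operator. Finally, the algebra of quantum matrices is a domain, being
an iterated Ore extension in the lexicographic order of the generators (`noZeroDivisors_insert`). -/

/-! ### Inversions of tuples and `q`-alternating functions -/

/-- The number of inversions of a tuple. -/
def tupleInv {t n : ℕ} (a : Fin t → Fin n) : ℕ :=
  (Finset.univ.filter fun p : Fin t × Fin t => p.1 < p.2 ∧ a p.2 < a p.1).card

/-- The quantum sign of a tuple: `(-q)` to the number of inversions, or zero if an entry is repeated. -/
noncomputable def tupleSign {K : Type*} [Field K] (q : K) {t n : ℕ} (a : Fin t → Fin n) : K :=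
  open Classical in if Function.Injective a then (-q) ^ tupleInv a else 0

/-- A function of tuples is `q`-alternating if it vanishes on tuples with two equal neighbours and is
multiplied by `-q` when an adjacent ascent is exchanged. -/
structure QAlternating {K : Type*} [Field K] (q : K) {A : Type*} [AddCommGroup A] [Module K A] {t n : ℕ}
    (f : (Fin t → Fin n) → A) : Prop where
  eq_zero : ∀ (c : Fin t → Fin n) (r : ℕ) (hr : r + 1 < t),
    c ⟨r, Nat.lt_of_succ_lt hr⟩ = c ⟨r + 1, hr⟩ → f c = 0
  swap : ∀ (c : Fin t → Fin n) (r : ℕ) (hr : r + 1 < t), c ⟨r, Nat.lt_of_succ_lt hr⟩ < c ⟨r + 1, hr⟩ →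
    f (c ∘ Equiv.swap ⟨r, Nat.lt_of_succ_lt hr⟩ ⟨r + 1, hr⟩) = (-q) • f c

theorem swap_lt_swap_iff {t r : ℕ} (hr : r + 1 < t) {i j : Fin t}
    (h : ¬ (i.val = r ∧ j.val = r + 1)) (h' : ¬ (i.val = r + 1 ∧ j.val = r)) :
    Equiv.swap (⟨r, Nat.lt_of_succ_lt hr⟩ : Fin t) ⟨r + 1, hr⟩ i < Equiv.swap (⟨r, Nat.lt_of_succ_lt hr⟩ : Fin t) ⟨r + 1, hr⟩ j
      ↔ i < j := by
  simp only [Equiv.swap_apply_def, Fin.ext_iff, Fin.lt_def]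
  split_ifs <;> simp_all <;> omega

/-- An adjacent transposition changes the relative order of only one pair of positions, so it
carries the old inversions bijectively to the new ones other than the pair `(r, r + 1)`. -/
theorem tupleInv_swap {t n : ℕ} (c : Fin t → Fin n) (r : ℕ) (hr : r + 1 < t)
    (h : c ⟨r, Nat.lt_of_succ_lt hr⟩ < c ⟨r + 1, hr⟩) :
    tupleInv (c ∘ Equiv.swap ⟨r, Nat.lt_of_succ_lt hr⟩ ⟨r + 1, hr⟩) = tupleInv c + 1 := by
  set s := Equiv.swap (⟨r, Nat.lt_of_succ_lt hr⟩ : Fin t) ⟨r + 1, hr⟩ with hs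
  have key : (Finset.univ.filter fun p : Fin t × Fin t => p.1 < p.2 ∧ (c ∘ s) p.2 < (c ∘ s) p.1) =
      insert (⟨r, Nat.lt_of_succ_lt hr⟩, ⟨r + 1, hr⟩) (((Finset.univ.filter fun p : Fin t × Fin t =>
        p.1 < p.2 ∧ c p.2 < c p.1)).map (s.prodCongr s).toEmbedding) := by
    ext ⟨i, j⟩
    simp only [Finset.mem_filter, Finset.mem_univ, true_and, Finset.mem_insert, Prod.mk.injEq,
      Finset.mem_map_equiv, Function.comp_apply]
    have e : (s.prodCongr s).symm (i, j) = (s i, s j) := by simp [hs]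
    rw [e]
    by_cases h1 : i.val = r ∧ j.val = r + 1
    · obtain ⟨hi, hj⟩ := h1
      rw [show i = ⟨r, Nat.lt_of_succ_lt hr⟩ from Fin.ext hi, show j = ⟨r + 1, hr⟩ from Fin.ext hj]
      simp [hs, h]
    · have h1' : ¬ (i = ⟨r, Nat.lt_of_succ_lt hr⟩ ∧ j = ⟨r + 1, hr⟩) := by simpa [Fin.ext_iff] using h1
      by_cases h2 : i.val = r + 1 ∧ j.val = r
      · obtain ⟨hi, hj⟩ := h2
        rw [show j = ⟨r, Nat.lt_of_succ_lt hr⟩ from Fin.ext hj, show i = ⟨r + 1, hr⟩ from Fin.ext hi]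
        simp [hs, h.le]
      · simp only [h1', false_or, hs, swap_lt_swap_iff hr h1 h2]
  rw [tupleInv, key, Finset.card_insert_of_notMem, Finset.card_map, tupleInv]
  simp only [Finset.mem_map_equiv, Finset.mem_filter, Finset.mem_univ, true_and]
  simp [hs]

theorem tupleSign_of_injective {K : Type*} [Field K] (q : K) {t n : ℕ} {a : Fin t → Fin n}
    (h : Function.Injective a) : tupleSign q a = (-q) ^ tupleInv a := by
  simp [tupleSign, h]

theorem tupleSign_of_not_injective {K : Type*} [Field K] (q : K) {t n : ℕ} {a : Fin t → Fin n}
    (h : ¬ Function.Injective a) : tupleSign q a = 0 := by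
  simp [tupleSign, h]

theorem tupleSign_qAlternating {K : Type*} [Field K] (q : K) (t n : ℕ) :
    QAlternating q (tupleSign q : (Fin t → Fin n) → K) where
  eq_zero c r hr h := tupleSign_of_not_injective q fun hc => by
    have := congrArg Fin.val (hc h)
    simp at this
  swap c r hr h := by
    by_cases hc : Function.Injective c
    · rw [tupleSign_of_injective q hc, tupleSign_of_injective q (hc.comp (Equiv.injective _)),
        tupleInv_swap c r hr h, pow_succ', smul_eq_mul]
    · rw [tupleSign_of_not_injective q hc, tupleSign_of_not_injective, smul_zero]
      rwa [Equiv.injective_comp]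

theorem tuple_strictMono_of_lt_succ {t n : ℕ} {c : Fin t → Fin n}
    (h : ∀ (r : ℕ) (hr : r + 1 < t), c ⟨r, Nat.lt_of_succ_lt hr⟩ < c ⟨r + 1, hr⟩) : StrictMono c := by
  cases t with
  | zero => exact fun i => i.elim0
  | succ t =>
    rw [Fin.strictMono_iff_lt_succ]
    intro i
    exact h i.val (by omega)

theorem tupleInv_strictMono {t n : ℕ} {c : Fin t → Fin n} (h : StrictMono c) : tupleInv c = 0 := by
  rw [tupleInv, Finset.card_eq_zero, Finset.filter_eq_empty_iff]
  rintro ⟨i, j⟩ - ⟨h1, h2⟩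
  exact lt_asymm (h h1) h2

theorem strictMono_eq_of_range_eq {t n : ℕ} {c d : Fin t → Fin n} (hc : StrictMono c)
    (hd : StrictMono d) (h : Set.range c = Set.range d) : c = d :=
  (StrictMono.range_inj hc hd).1 h

namespace QAlternating

variable {K : Type*} [Field K] {q : K} {A : Type*} [AddCommGroup A] [Module K A] {t n : ℕ}
  {f : (Fin t → Fin n) → A}

/-- Bubble sort, by induction on the number of inversions. A tuple that is not strictly increasing
has a weak descent between neighbours: equality gives zero, and exchanging a strict descent removes
one inversion and contributes a factor `-q`. -/
theorem sort_aux (hf : QAlternating q f) (N : ℕ) : ∀ c : Fin t → Fin n, tupleInv c = N →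
    (¬ Function.Injective c → f c = 0) ∧ (Function.Injective c → ∀ d : Fin t → Fin n, StrictMono d →
      Set.range c = Set.range d → f c = (-q) ^ N • f d) := by
  induction N with
  | zero =>
    intro c hc
    by_cases h : StrictMono c
    · refine ⟨fun h' => (h' h.injective).elim, fun _ d hd hr => ?_⟩
      rw [strictMono_eq_of_range_eq h hd hr, pow_zero, one_smul]
    · obtain ⟨r, hr, hlt⟩ : ∃ (r : ℕ) (hr : r + 1 < t), ¬ c ⟨r, Nat.lt_of_succ_lt hr⟩ < c ⟨r + 1, hr⟩ := by
        by_contra! h'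
        exact h (tuple_strictMono_of_lt_succ h')
      have hle : ¬ c ⟨r + 1, hr⟩ < c ⟨r, Nat.lt_of_succ_lt hr⟩ := fun h' => by
        rw [tupleInv, Finset.card_eq_zero, Finset.filter_eq_empty_iff] at hc
        exact hc (x := (⟨r, Nat.lt_of_succ_lt hr⟩, ⟨r + 1, hr⟩)) (Finset.mem_univ _) ⟨by simp [Fin.lt_def], h'⟩
      have heq : c ⟨r, Nat.lt_of_succ_lt hr⟩ = c ⟨r + 1, hr⟩ := le_antisymm (not_lt.1 hle) (not_lt.1 hlt)
      refine ⟨fun _ => hf.eq_zero c r hr heq, fun hi => ?_⟩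
      have := congrArg Fin.val (hi heq)
      simp at this
  | succ N ih =>
    intro c hc
    have h : ¬ StrictMono c := fun h => by rw [tupleInv_strictMono h] at hc; omega
    obtain ⟨r, hr, hlt⟩ : ∃ (r : ℕ) (hr : r + 1 < t), ¬ c ⟨r, Nat.lt_of_succ_lt hr⟩ < c ⟨r + 1, hr⟩ := by
      by_contra! h'
      exact h (tuple_strictMono_of_lt_succ h')
    rcases (not_lt.1 hlt).eq_or_lt with heq | hgt
    · refine ⟨fun _ => hf.eq_zero c r hr heq.symm, fun hi => ?_⟩
      have := congrArg Fin.val (hi heq)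
      simp at this
    · set s := Equiv.swap (⟨r, Nat.lt_of_succ_lt hr⟩ : Fin t) ⟨r + 1, hr⟩ with hs
      have hlt' : (c ∘ s) ⟨r, Nat.lt_of_succ_lt hr⟩ < (c ∘ s) ⟨r + 1, hr⟩ := by simpa [hs] using hgt
      have hcc : (c ∘ s) ∘ s = c := by funext i; simp [hs]
      have hinv := tupleInv_swap (c ∘ s) r hr hlt'
      have hfc := hf.swap (c ∘ s) r hr hlt'
      rw [← hs, hcc] at hinv hfc
      obtain ⟨h1, h2⟩ := ih (c ∘ s) (by omega)
      refine ⟨fun hi => ?_, fun hi d hd hr => ?_⟩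
      · rw [hfc, h1 (by rwa [Equiv.injective_comp]), smul_zero]
      · rw [hfc, h2 (hi.comp s.injective) d hd (by rw [← hr, s.surjective.range_comp]), smul_smul,
          pow_succ']

theorem eq_zero_of_not_injective (hf : QAlternating q f) {c : Fin t → Fin n}
    (hc : ¬ Function.Injective c) : f c = 0 :=
  (hf.sort_aux _ c rfl).1 hc

theorem comp_perm (hf : QAlternating q f) {c : Fin t → Fin n} (hc : StrictMono c)
    (σ : Equiv.Perm (Fin t)) : f (c ∘ σ) = (-q) ^ permLength σ • f c := by
  have h : tupleInv (c ∘ σ) = permLength σ := by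
    simp [tupleInv, permLength, hc.lt_iff_lt]
  rw [← h]
  exact (hf.sort_aux _ _ rfl).2 (hc.injective.comp σ.injective) c hc
    (by rw [σ.surjective.range_comp])

end QAlternating

theorem tupleSign_strictMono {K : Type*} [Field K] (q : K) {t n : ℕ} {c : Fin t → Fin n}
    (h : StrictMono c) : tupleSign q c = 1 := by
  rw [tupleSign_of_injective q h.injective, tupleInv_strictMono h, pow_zero]

/-! ### Increasing enumerations and signed sums over tuples -/

/-- The increasing enumeration of a set of prescribed cardinality. -/
def enum {t n : ℕ} (J : {J : Finset (Fin n) // J.card = t}) : Fin t → Fin n :=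
  J.1.orderEmbOfFin J.2

theorem enum_strictMono {t n : ℕ} (J : {J : Finset (Fin n) // J.card = t}) : StrictMono (enum J) :=
  (J.1.orderEmbOfFin J.2).strictMono

theorem range_enum {t n : ℕ} (J : {J : Finset (Fin n) // J.card = t}) :
    Set.range (enum J) = J.1 :=
  Finset.range_orderEmbOfFin J.1 J.2

theorem enum_mem {t n : ℕ} (J : {J : Finset (Fin n) // J.card = t}) (i : Fin t) : enum J i ∈ J.1 :=
  Finset.orderEmbOfFin_mem J.1 J.2 i

theorem eq_enum_of_strictMono {t n : ℕ} {c : Fin t → Fin n} (hc : StrictMono c)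
    (J : {J : Finset (Fin n) // J.card = t}) (h : ∀ i, c i ∈ J.1) : c = enum J :=
  Finset.orderEmbOfFin_unique J.2 h hc

theorem enum_comp_perm_injective {t n : ℕ} {J J' : {J : Finset (Fin n) // J.card = t}}
    {σ σ' : Equiv.Perm (Fin t)} (h : enum J ∘ σ = enum J' ∘ σ') : J = J' ∧ σ = σ' := by
  have hJ : J = J' := by
    apply Subtype.ext
    rw [← Finset.coe_inj, ← range_enum, ← range_enum, ← σ.surjective.range_comp (enum J), h,
      σ'.surjective.range_comp]
  subst hJ
  exact ⟨rfl, Equiv.ext fun i => (enum_strictMono J).injective (congrFun h i)⟩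

/-- A sum over tuples of a function vanishing on tuples with repetitions, grouped by the set of
entries. -/
theorem sum_tuples {M : Type*} [AddCommMonoid M] {t n : ℕ} (F : (Fin t → Fin n) → M)
    (hF : ∀ a, ¬ Function.Injective a → F a = 0) :
    ∑ a, F a = ∑ J : {J : Finset (Fin n) // J.card = t}, ∑ σ : Equiv.Perm (Fin t), F (enum J ∘ σ) := by
  classical
  rw [← Finset.sum_product', ← Finset.sum_filter_of_ne (p := fun a => Function.Injective a)
    fun a _ h => by by_contra h'; exact h (hF a h')]
  symm
  refine Finset.sum_bij (fun p _ => enum p.1 ∘ p.2) ?_ ?_ ?_ ?_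
  · rintro ⟨J, σ⟩ -
    simpa using (enum_strictMono J).injective.comp σ.injective
  · rintro ⟨J, σ⟩ - ⟨J', σ'⟩ - h
    obtain ⟨rfl, rfl⟩ := enum_comp_perm_injective h
    rfl
  · intro a ha
    have ha : Function.Injective a := by simpa using ha
    let J : {J : Finset (Fin n) // J.card = t} :=
      ⟨Finset.univ.image a, by rw [Finset.card_image_of_injective _ ha, Finset.card_fin]⟩
    have h (i : Fin t) : ∃ j, enum J j = a i := by
      have : a i ∈ Set.range (enum J) := by rw [range_enum]; simp [J]
      exact this
    choose g hg using h
    have hg' : Function.Injective g := fun i j hij => ha (by rw [← hg, ← hg, hij])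
    refine ⟨(J, Equiv.ofBijective g (Finite.injective_iff_bijective.1 hg')), by simp, ?_⟩
    funext i
    simp [hg]
  · intro _ _
    rfl

theorem append_comp_swap_right {s t n : ℕ} (c' : Fin s → Fin n) (c : Fin t → Fin n) (i j : Fin t) :
    Fin.append c' (c ∘ Equiv.swap i j) =
      Fin.append c' c ∘ Equiv.swap (Fin.natAdd s i) (Fin.natAdd s j) := by
  funext x
  refine Fin.addCases (fun y => ?_) (fun y => ?_) x
  · rw [Function.comp_apply, Equiv.swap_apply_of_ne_of_ne, Fin.append_left, Fin.append_left]
    · exact fun h => by have := congrArg Fin.val h; simp at this; omega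
    · exact fun h => by have := congrArg Fin.val h; simp at this; omega
  · rw [Function.comp_apply, Fin.append_right, Function.comp_apply,
      ← (Fin.natAdd_injective t s).map_swap, Fin.append_right]

theorem append_comp_swap_left {s t n : ℕ} (c : Fin s → Fin n) (c' : Fin t → Fin n) (i j : Fin s) :
    Fin.append (c ∘ Equiv.swap i j) c' =
      Fin.append c c' ∘ Equiv.swap (Fin.castAdd t i) (Fin.castAdd t j) := by
  funext x
  refine Fin.addCases (fun y => ?_) (fun y => ?_) x
  · rw [Function.comp_apply, Fin.append_left, Function.comp_apply,
      ← (Fin.castAdd_injective s t).map_swap, Fin.append_left]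
  · rw [Function.comp_apply, Equiv.swap_apply_of_ne_of_ne, Fin.append_right, Fin.append_right]
    · exact fun h => by have := congrArg Fin.val h; simp at this; omega
    · exact fun h => by have := congrArg Fin.val h; simp at this; omega

section Append

variable {K : Type*} [Field K] {q : K} {A : Type*} [AddCommGroup A] [Module K A] {s t n : ℕ}

theorem QAlternating.append_right {f : (Fin (s + t) → Fin n) → A} (hf : QAlternating q f)
    (c' : Fin s → Fin n) : QAlternating q fun c => f (Fin.append c' c) where
  eq_zero c r hr h := by
    refine hf.eq_zero _ (s + r) (by omega) ?_
    have e1 := Fin.append_right c' c ⟨r, Nat.lt_of_succ_lt hr⟩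
    have e2 := Fin.append_right c' c ⟨r + 1, hr⟩
    rw [h, ← e2] at e1
    exact e1
  swap c r hr h := by
    have e1 := Fin.append_right c' c ⟨r, Nat.lt_of_succ_lt hr⟩
    have e2 := Fin.append_right c' c ⟨r + 1, hr⟩
    rw [← e1, ← e2] at h
    rw [append_comp_swap_right]
    exact hf.swap (Fin.append c' c) (s + r) (by omega) h

theorem QAlternating.append_left {f : (Fin (s + t) → Fin n) → A} (hf : QAlternating q f)
    (c' : Fin t → Fin n) : QAlternating q fun c => f (Fin.append c c') where
  eq_zero c r hr h := by
    refine hf.eq_zero _ r (by omega) ?_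
    have e1 := Fin.append_left c c' ⟨r, Nat.lt_of_succ_lt hr⟩
    have e2 := Fin.append_left c c' ⟨r + 1, hr⟩
    rw [h, ← e2] at e1
    exact e1
  swap c r hr h := by
    have e1 := Fin.append_left c c' ⟨r, Nat.lt_of_succ_lt hr⟩
    have e2 := Fin.append_left c c' ⟨r + 1, hr⟩
    rw [← e1, ← e2] at h
    rw [append_comp_swap_left]
    exact hf.swap (Fin.append c c') r (by omega) h

/-- The sign is `q`-alternating in each block separately, so both blocks can be sorted
independently. This multiplicativity is the combinatorial content of Laplace expansion. -/
theorem tupleSign_append_comp (q : K) {c : Fin s → Fin n} {d : Fin t → Fin n} (hc : StrictMono c)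
    (hd : StrictMono d) (σ : Equiv.Perm (Fin s)) (τ : Equiv.Perm (Fin t)) :
    tupleSign q (Fin.append (c ∘ σ) (d ∘ τ)) =
      (-q) ^ permLength σ * ((-q) ^ permLength τ * tupleSign q (Fin.append c d)) := by
  have h1 := ((tupleSign_qAlternating q (s + t) n).append_left (d ∘ τ)).comp_perm hc σ
  have h2 := ((tupleSign_qAlternating q (s + t) n).append_right c).comp_perm hd τ
  simp only [smul_eq_mul] at h1 h2
  rw [h1, h2]

theorem not_injective_append_of_left {c : Fin s → Fin n} (d : Fin t → Fin n)
    (h : ¬ Function.Injective c) : ¬ Function.Injective (Fin.append c d) := fun h' =>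
  h fun i j hij => Fin.castAdd_injective s t (h' (by simpa using hij))

theorem not_injective_append_of_right (c : Fin s → Fin n) {d : Fin t → Fin n}
    (h : ¬ Function.Injective d) : ¬ Function.Injective (Fin.append c d) := fun h' =>
  h fun i j hij => Fin.natAdd_injective t s (h' (by simpa using hij))

/-- A signed sum over tuples, split into an initial and a final part, each of which is grouped by its
set of entries. -/
theorem sum_append_tuples (q : K) (F : (Fin (s + t) → Fin n) → A) :
    ∑ c, tupleSign q c • F c =
      ∑ I : {J : Finset (Fin n) // J.card = s}, ∑ J : {J : Finset (Fin n) // J.card = t},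
        tupleSign q (Fin.append (enum I) (enum J)) •
          ∑ σ : Equiv.Perm (Fin s), ∑ τ : Equiv.Perm (Fin t),
            ((-q) ^ permLength σ * (-q) ^ permLength τ) •
              F (Fin.append (enum I ∘ σ) (enum J ∘ τ)) := by
  rw [← (Fin.appendEquiv s t).sum_comp, Fintype.sum_prod_type]
  simp only [Fin.appendEquiv, Equiv.coe_fn_mk]
  rw [sum_tuples]
  · refine Finset.sum_congr rfl fun I _ => ?_
    simp_rw [Finset.smul_sum]
    rw [Finset.sum_comm (s := Finset.univ (α := {J : Finset (Fin n) // J.card = t}))]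
    refine Finset.sum_congr rfl fun σ _ => ?_
    rw [sum_tuples]
    · refine Finset.sum_congr rfl fun J _ => Finset.sum_congr rfl fun τ _ => ?_
      rw [tupleSign_append_comp q (enum_strictMono I) (enum_strictMono J), smul_smul]
      congr 1
      ring
    · intro a ha
      rw [tupleSign_of_not_injective q (not_injective_append_of_right _ ha), zero_smul]
  · intro a ha
    refine Finset.sum_eq_zero fun b _ => ?_
    rw [tupleSign_of_not_injective q (not_injective_append_of_left _ ha), zero_smul]

end Append

/-! ### Complementary sets and their signs -/

/-- Together `u` and `v` list every index once. Of the `v p` indices below `v p`, exactly `p` occur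
in `v`, so `v p - p` occur in `u`; the other entries of `u` lie above. -/
theorem card_lt_add_card_gt {s t n : ℕ} (hn : s + t = n) {u : Fin s → Fin n} {v : Fin t → Fin n}
    (hv : StrictMono v) (h : Function.Injective (Fin.append u v)) (p : Fin t) :
    (∑ x, if v p < u x then 1 else 0) + (v p).val = s + p.val := by
  have hb : Function.Bijective (Fin.append u v) :=
    (Fintype.bijective_iff_injective_and_card _).2 ⟨h, by simp [hn]⟩
  have h1 : (∑ x, if u x < v p then 1 else 0) + (∑ y, if v y < v p then 1 else 0) = (v p).val := by
    have := hb.sum_comp fun a => if a < v p then 1 else 0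
    rw [Fin.sum_univ_add] at this
    simp only [Fin.append_left, Fin.append_right] at this
    rw [this, Finset.sum_boole]
    simp [Finset.filter_gt_eq_Iio]
  have h2 : (∑ y, if v y < v p then 1 else 0) = p.val := by
    rw [Finset.sum_boole]
    simp [hv.lt_iff_lt, Finset.filter_gt_eq_Iio]
  have h3 : (∑ x, if v p < u x then 1 else 0) + (∑ x, if u x < v p then 1 else 0) = s := by
    rw [← Finset.sum_add_distrib]
    refine (Finset.sum_congr rfl (g := fun _ => 1) fun x _ => ?_).trans (by simp)
    have hne : u x ≠ v p := fun h' => by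
      have := @h (Fin.castAdd t x) (Fin.natAdd s p) (by simpa using h')
      have := congrArg Fin.val this
      simp at this
      omega
    rcases lt_or_gt_of_ne hne with h4 | h4 <;> simp [h4, h4.le]
  omega

/-- The number of inversions of the concatenation of two complementary increasing tuples. -/
theorem tupleInv_append {s t n : ℕ} (hn : s + t = n) {u : Fin s → Fin n} {v : Fin t → Fin n}
    (hu : StrictMono u) (hv : StrictMono v) (h : Function.Injective (Fin.append u v)) :
    tupleInv (Fin.append u v) + ∑ p, (v p).val = ∑ p : Fin t, (s + p.val) := by
  have h0 : tupleInv (Fin.append u v) = ∑ p : Fin t, ∑ x, if v p < u x then 1 else 0 := by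
    rw [tupleInv, Finset.card_filter, Fintype.sum_prod_type, Fin.sum_univ_add]
    simp only [Fin.sum_univ_add, Fin.append_left, Fin.append_right]
    have e1 (x y : Fin s) : ¬ (Fin.castAdd t x < Fin.castAdd t y ∧ u y < u x) := by
      rintro ⟨h1, h2⟩
      exact lt_asymm h2 (hu h1)
    have e2 (x y : Fin t) : ¬ (Fin.natAdd s x < Fin.natAdd s y ∧ v y < v x) := by
      rintro ⟨h1, h2⟩
      exact lt_asymm h2 (hv (by simpa using h1))
    have e3 (x : Fin s) (y : Fin t) : Fin.castAdd t x < Fin.natAdd s y := by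
      rw [Fin.lt_def]; simp; omega
    simp only [e1, e2, if_false, e3, true_and, (e3 _ _).not_gt, false_and, Finset.sum_const_zero,
      zero_add, add_zero]
    exact Finset.sum_comm
  rw [h0, ← Finset.sum_add_distrib]
  exact Finset.sum_congr rfl fun p _ => card_lt_add_card_gt hn hv h p

/-- The complement of a set, with prescribed cardinality. -/
def complSet {s t n : ℕ} (hn : s + t = n) (J : {J : Finset (Fin n) // J.card = t}) :
    {J : Finset (Fin n) // J.card = s} :=
  ⟨J.1ᶜ, by rw [Finset.card_compl, Fintype.card_fin, J.2]; omega⟩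

theorem injective_append_enum_iff {s t n : ℕ} (hn : s + t = n)
    (I : {J : Finset (Fin n) // J.card = s}) (J : {J : Finset (Fin n) // J.card = t}) :
    Function.Injective (Fin.append (enum I) (enum J)) ↔ I = complSet hn J := by
  rw [Fin.append_injective_iff]
  constructor
  · rintro ⟨-, -, h⟩
    apply Subtype.ext
    refine Finset.eq_of_subset_of_card_le (fun a ha => ?_) (by rw [I.2, (complSet hn J).2])
    rw [complSet, Finset.mem_compl]
    intro ha'
    rw [← Finset.mem_coe, ← range_enum] at ha ha'
    obtain ⟨i, rfl⟩ := ha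
    obtain ⟨j, hj⟩ := ha'
    exact h i j hj.symm
  · rintro rfl
    refine ⟨(enum_strictMono _).injective, (enum_strictMono _).injective, fun i j h => ?_⟩
    have := enum_mem (complSet hn J) i
    rw [h, complSet, Finset.mem_compl] at this
    exact this (enum_mem J j)

/-- The sign of the permutation that lists the complement of a set before the set. -/
noncomputable def complSign {K : Type*} [Field K] (q : K) {s t n : ℕ} (hn : s + t = n)
    (J : {J : Finset (Fin n) // J.card = t}) : K :=
  tupleSign q (Fin.append (enum (complSet hn J)) (enum J))

theorem tupleSign_append_enum {K : Type*} [Field K] (q : K) {s t n : ℕ} (hn : s + t = n)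
    (I : {J : Finset (Fin n) // J.card = s}) (J : {J : Finset (Fin n) // J.card = t}) :
    tupleSign q (Fin.append (enum I) (enum J)) = if I = complSet hn J then complSign q hn J else 0 := by
  split_ifs with h
  · rw [h, complSign]
  · exact tupleSign_of_not_injective q fun h' => h ((injective_append_enum_iff hn I J).1 h')

/-- The sign depends on `J` only through the sum of its elements. This is what later allows a
rescaling of the columns to absorb it. -/
theorem complSign_mul_pow {K : Type*} [Field K] (q : K) {s t n : ℕ} (hn : s + t = n)
    (J : {J : Finset (Fin n) // J.card = t}) :
    complSign q hn J * (-q) ^ ∑ p, (enum J p).val = (-q) ^ ∑ p : Fin t, (s + p.val) := by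
  have h := (injective_append_enum_iff hn _ J).2 rfl
  rw [complSign, tupleSign_of_injective q h, ← pow_add,
    tupleInv_append hn (enum_strictMono _) (enum_strictMono _) h]

theorem complSign_ne_zero {K : Type*} [Field K] {q : K} (hq : q ≠ 0) {s t n : ℕ} (hn : s + t = n)
    (J : {J : Finset (Fin n) // J.card = t}) : complSign q hn J ≠ 0 := by
  intro h
  have := complSign_mul_pow q hn J
  rw [h, zero_mul] at this
  exact pow_ne_zero _ (neg_ne_zero.2 hq) this.symm

theorem sum_subsets_card_one {M : Type*} [AddCommMonoid M] {n : ℕ}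
    (F : {J : Finset (Fin n) // J.card = 1} → M) : ∑ J, F J = ∑ i, F ⟨{i}, Finset.card_singleton i⟩ := by
  symm
  refine Finset.sum_bij (fun i _ => ⟨{i}, Finset.card_singleton i⟩) (fun _ _ => Finset.mem_univ _)
    (fun i _ j _ h => by simpa using h) (fun J _ => ?_) fun _ _ => rfl
  obtain ⟨i, hi⟩ := Finset.card_eq_one.1 J.2
  exact ⟨i, Finset.mem_univ _, Subtype.ext hi.symm⟩

theorem enum_singleton {n : ℕ} (i : Fin n) (p : Fin 1) :
    enum ⟨{i}, Finset.card_singleton i⟩ p = i := by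
  have := enum_mem (⟨{i}, Finset.card_singleton i⟩ : {J : Finset (Fin n) // J.card = 1}) p
  simpa using this

/-- A sum over permutations of `Fin n`, as a sum over tuples. -/
theorem sum_perm_eq_sum_tuples {K : Type*} [Field K] (q : K) {A : Type*} [AddCommGroup A] [Module K A]
    {n : ℕ} (F : (Fin n → Fin n) → A) :
    ∑ σ : Equiv.Perm (Fin n), (-q) ^ permLength σ • F σ = ∑ c, tupleSign q c • F c := by
  rw [sum_tuples]
  · have : Subsingleton {J : Finset (Fin n) // J.card = n} :=
      ⟨fun J J' => Subtype.ext <| by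
        rw [Finset.card_eq_iff_eq_univ J.1 |>.1 (by simp [J.2]),
          Finset.card_eq_iff_eq_univ J'.1 |>.1 (by simp [J'.2])]⟩
    rw [Fintype.sum_subsingleton _ (⟨Finset.univ, Finset.card_fin n⟩ :
      {J : Finset (Fin n) // J.card = n})]
    refine Finset.sum_congr rfl fun σ _ => ?_
    rw [← eq_enum_of_strictMono (c := id) strictMono_id ⟨Finset.univ, Finset.card_fin n⟩
      (fun i => Finset.mem_univ _)]
    have := (tupleSign_qAlternating q n n).comp_perm strictMono_id σ
    rw [this, tupleSign_strictMono q strictMono_id, smul_eq_mul, mul_one, Function.id_comp]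
  · intro a ha
    rw [tupleSign_of_not_injective q ha, zero_smul]

/-- The Poincaré polynomial of the symmetric group, evaluated at `q ^ 2`, does not vanish. -/
theorem sum_pow_permLength_ne_zero {K : Type*} [Field K] {q : K} (hq : ∀ r : ℕ, 0 < r → q ^ r ≠ 1)
    (n : ℕ) : ∑ σ : Equiv.Perm (Fin n), (-q) ^ permLength σ * (-q) ^ permLength σ ≠ 0 := by
  induction n with
  | zero => simp [permLength]
  | succ n ih =>
    -- Splitting off the last entry factors the sum as `(1 + q ^ 2 + ⋯ + q ^ (2 n))` times the sum
    -- for `n`: a last entry `i` takes part in `n - i` inversions with the entries before it.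
    have h1 : ∑ σ : Equiv.Perm (Fin (n + 1)), (-q) ^ permLength σ * (-q) ^ permLength σ =
        ∑ c : Fin (n + 1) → Fin (n + 1), tupleSign q c • tupleSign q c := by
      rw [← sum_perm_eq_sum_tuples]
      refine Finset.sum_congr rfl fun σ _ => ?_
      have := (tupleSign_qAlternating q (n + 1) (n + 1)).comp_perm strictMono_id σ
      rw [Function.id_comp, tupleSign_strictMono q strictMono_id] at this
      simp [this]
    have h2 : ∑ i : Fin (n + 1), complSign q (rfl : n + 1 = n + 1) ⟨{i}, Finset.card_singleton i⟩ *
        complSign q (rfl : n + 1 = n + 1) ⟨{i}, Finset.card_singleton i⟩ =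
        ∑ i ∈ Finset.range (n + 1), (q ^ 2) ^ i := by
      rw [← Finset.sum_range_reflect, Finset.sum_range]
      refine Finset.sum_congr rfl fun i _ => ?_
      have h := (injective_append_enum_iff (rfl : n + 1 = n + 1) _
        ⟨{i}, Finset.card_singleton i⟩).2 rfl
      have h' := tupleInv_append (rfl : n + 1 = n + 1) (enum_strictMono _) (enum_strictMono _) h
      simp only [enum_singleton, Finset.univ_unique, Finset.sum_singleton, Fin.default_eq_zero,
        Fin.val_zero, add_zero] at h'
      rw [complSign, tupleSign_of_injective q h, ← mul_pow, neg_mul_neg, ← sq,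
        show n + 1 - 1 - i.val = tupleInv (Fin.append
          (enum (complSet (rfl : n + 1 = n + 1) ⟨{i}, Finset.card_singleton i⟩))
          (enum ⟨{i}, Finset.card_singleton i⟩)) by omega]
    -- If the geometric sum vanished, multiplying it by `q ^ 2 - 1` would give `q ^ (2 (n + 1)) =
    -- 1`.
    have h3 : ∑ i ∈ Finset.range (n + 1), (q ^ 2) ^ i ≠ 0 := by
      intro h
      have := geom_sum_mul (q ^ 2) (n + 1)
      rw [h, zero_mul, ← pow_mul] at this
      exact hq (2 * (n + 1)) (by omega) (sub_eq_zero.1 this.symm)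
    rw [h1, sum_append_tuples, Finset.sum_comm, sum_subsets_card_one]
    simp_rw [tupleSign_append_comp q (enum_strictMono _) (enum_strictMono _),
      tupleSign_append_enum q (rfl : n + 1 = n + 1), ite_smul, zero_smul]
    simp only [Finset.sum_ite_eq', Finset.mem_univ, if_true]
    refine ne_of_eq_of_ne ?_ (mul_ne_zero (mul_ne_zero h3 ih) one_ne_zero)
    rw [← h2, mul_one, Finset.sum_mul]
    refine Finset.sum_congr rfl fun i _ => ?_
    rw [smul_eq_mul, Finset.mul_sum, Finset.mul_sum]
    refine Finset.sum_congr rfl fun σ _ => ?_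
    have h4 (σ : Equiv.Perm (Fin 1)) : permLength σ = 0 := by
      simp [permLength, Subsingleton.elim _ (0 : Fin 1)]
    simp only [h4, Finset.univ_unique, Finset.sum_singleton, smul_eq_mul, pow_zero, mul_one]
    ring

/-! ### Quantum minors: alternation, transposition and Laplace expansion -/

/-- A matrix with entries in a `K`-algebra satisfying the relations of quantum matrices. -/
structure IsQuantum {K : Type*} [Field K] (q : K) {A : Type*} [Ring A] [Algebra K A] {m n : ℕ}
    (x : Matrix (Fin m) (Fin n) A) : Prop where
  row : ∀ i j l, j < l → x i j * x i l = q • (x i l * x i j)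
  col : ∀ i k j, i < k → x i j * x k j = q • (x k j * x i j)
  anti : ∀ i k j l, k < i → j < l → x i j * x k l = x k l * x i j
  diag : ∀ i k j l, i < k → j < l →
    x i j * x k l - x k l * x i j = (q - q⁻¹) • (x i l * x k j)

theorem IsQuantum.transpose {K : Type*} [Field K] {q : K} {A : Type*} [Ring A] [Algebra K A] {m n : ℕ}
    {x : Matrix (Fin m) (Fin n) A} (hx : IsQuantum q x) : IsQuantum q x.transpose where
  row i j l h := hx.col j l i h
  col i k j h := hx.row j i k h
  anti i k j l h h' := (hx.anti l j k i h' h).symm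
  diag i k j l h h' := by
    have := hx.diag j l i k h' h
    rw [← hx.anti l j i k h' h] at this
    exact this

/-- The ordered product of the entries of `x` at positions `(a 1, b 1), …, (a t, b t)`. -/
def tupleProd {A : Type*} [Ring A] {m n t : ℕ} (x : Matrix (Fin m) (Fin n) A) (a : Fin t → Fin m)
    (b : Fin t → Fin n) : A :=
  (List.ofFn fun i => x (a i) (b i)).prod

/-- The quantum minor of a matrix on arbitrary tuples of rows and columns. -/
noncomputable def rowMinor {K : Type*} [Field K] (q : K) {A : Type*} [Ring A] [Algebra K A] {m n t : ℕ}
    (x : Matrix (Fin m) (Fin n) A) (a : Fin t → Fin m) (b : Fin t → Fin n) : A :=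
  ∑ σ : Equiv.Perm (Fin t), (-q) ^ permLength σ • tupleProd x a (b ∘ σ)

/-- Isolating two neighbouring factors of an ordered product. -/
theorem exists_prod_ofFn_eq {A : Type*} [Monoid A] : ∀ {t : ℕ} (g : Fin t → A) (r : ℕ) (hr : r + 1 < t),
    ∃ P S : A, ∀ g' : Fin t → A, (∀ i : Fin t, i.val ≠ r → i.val ≠ r + 1 → g' i = g i) →
      (List.ofFn g').prod = P * (g' ⟨r, Nat.lt_of_succ_lt hr⟩ * g' ⟨r + 1, hr⟩) * S
  | 0, _, _, hr => by omega
  | 1, _, _, hr => by omega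
  | t + 2, g, 0, hr => by
    refine ⟨1, (List.ofFn fun i : Fin t => g i.succ.succ).prod, fun g' h => ?_⟩
    have : (fun i : Fin t => g' i.succ.succ) = fun i => g i.succ.succ :=
      funext fun i => h _ (by simp) (by simp)
    rw [List.ofFn_succ, List.ofFn_succ, List.prod_cons, List.prod_cons, this, one_mul, mul_assoc]
    rfl
  | t + 2, g, r + 1, hr => by
    obtain ⟨P, S, h⟩ := exists_prod_ofFn_eq (fun i : Fin (t + 1) => g i.succ) r (by omega)
    refine ⟨g 0 * P, S, fun g' h' => ?_⟩
    rw [List.ofFn_succ, List.prod_cons, h (fun i => g' i.succ) fun i h1 h2 =>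
      h' _ (by simpa using h1) (by simpa using h2), h' 0 (by simp) (by simp)]
    simp only [mul_assoc]
    rfl

/-- Isolating two neighbouring factors of a product of matrix entries. -/
theorem exists_tupleProd_eq {A : Type*} [Ring A] {m n t : ℕ} (x : Matrix (Fin m) (Fin n) A)
    (a : Fin t → Fin m) (b : Fin t → Fin n) (r : ℕ) (hr : r + 1 < t) :
    ∃ P S : A, ∀ (a' : Fin t → Fin m) (b' : Fin t → Fin n),
      (∀ i : Fin t, i.val ≠ r → i.val ≠ r + 1 → a' i = a i) →
      (∀ i : Fin t, i.val ≠ r → i.val ≠ r + 1 → b' i = b i) →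
      tupleProd x a' b' = P * (x (a' ⟨r, Nat.lt_of_succ_lt hr⟩) (b' ⟨r, Nat.lt_of_succ_lt hr⟩) *
        x (a' ⟨r + 1, hr⟩) (b' ⟨r + 1, hr⟩)) * S := by
  obtain ⟨P, S, h⟩ := exists_prod_ofFn_eq (fun i => x (a i) (b i)) r hr
  exact ⟨P, S, fun a' b' ha hb => h _ fun i h1 h2 => by rw [ha i h1 h2, hb i h1 h2]⟩

section Minor

variable {K : Type*} [Field K] {q : K} {A : Type*} [Ring A] [Algebra K A] {m n t : ℕ}
  {x : Matrix (Fin m) (Fin n) A}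

theorem permLength_mul_swap (σ : Equiv.Perm (Fin t)) (r : ℕ) (hr : r + 1 < t)
    (h : σ ⟨r, Nat.lt_of_succ_lt hr⟩ < σ ⟨r + 1, hr⟩) :
    permLength (σ * Equiv.swap ⟨r, Nat.lt_of_succ_lt hr⟩ ⟨r + 1, hr⟩) = permLength σ + 1 :=
  tupleInv_swap σ r hr h

/-- A quantum minor as a sum over the permutations with an ascent at a given position. -/
theorem rowMinor_eq_sum_ascents (x : Matrix (Fin m) (Fin n) A) (a : Fin t → Fin m) (b : Fin t → Fin n)
    (r : ℕ) (hr : r + 1 < t) :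
    rowMinor q x a b =
      ∑ σ : Equiv.Perm (Fin t) with σ ⟨r, Nat.lt_of_succ_lt hr⟩ < σ ⟨r + 1, hr⟩,
        (-q) ^ permLength σ • (tupleProd x a (b ∘ σ) - q • tupleProd x a
          (b ∘ (σ * Equiv.swap ⟨r, Nat.lt_of_succ_lt hr⟩ ⟨r + 1, hr⟩ : Equiv.Perm (Fin t)))) := by
  set s := Equiv.swap (⟨r, Nat.lt_of_succ_lt hr⟩ : Fin t) ⟨r + 1, hr⟩ with hs
  rw [rowMinor, ← Finset.sum_filter_add_sum_filter_not _
    fun σ : Equiv.Perm (Fin t) => σ ⟨r, Nat.lt_of_succ_lt hr⟩ < σ ⟨r + 1, hr⟩]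
  simp_rw [smul_sub, Finset.sum_sub_distrib, sub_eq_add_neg]
  congr 1
  rw [← Finset.sum_neg_distrib]
  have hne : (⟨r + 1, hr⟩ : Fin t) ≠ ⟨r, Nat.lt_of_succ_lt hr⟩ := by simp
  refine Finset.sum_nbij' (fun σ => σ * s) (fun σ => σ * s) ?_ ?_ ?_ ?_ ?_
  · intro σ h
    simp only [Finset.mem_filter, Finset.mem_univ, true_and, not_lt, Equiv.Perm.mul_apply, hs,
      Equiv.swap_apply_left, Equiv.swap_apply_right] at h ⊢
    exact lt_of_le_of_ne h fun h' => hne (σ.injective h')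
  · intro σ h
    simp only [Finset.mem_filter, Finset.mem_univ, true_and, not_lt, Equiv.Perm.mul_apply, hs,
      Equiv.swap_apply_left, Equiv.swap_apply_right] at h ⊢
    exact h.le
  · intro σ _
    simp [mul_assoc, hs]
  · intro σ _
    simp [mul_assoc, hs]
  · intro σ h
    simp only [Finset.mem_filter, Finset.mem_univ, true_and, not_lt] at h
    have hσ : σ * s * s = σ := by simp [mul_assoc, hs]
    have hl := permLength_mul_swap (σ * s) r hr (by
      simp only [Equiv.Perm.mul_apply, hs, Equiv.swap_apply_left, Equiv.swap_apply_right]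
      exact lt_of_le_of_ne h fun h' => hne (σ.injective h'))
    rw [← hs, hσ] at hl
    rw [hσ, hl, pow_succ, smul_smul, ← neg_smul]
    congr 1
    ring

/-- Quantum minors are `q`-alternating in the rows. -/
theorem IsQuantum.rowMinor_qAlternating (hx : IsQuantum q x) (hq : q ≠ 0) {b : Fin t → Fin n}
    (hb : StrictMono b) : QAlternating q fun a : Fin t → Fin m => rowMinor q x a b where
  eq_zero a r hr h := by
    rw [rowMinor_eq_sum_ascents x a b r hr]
    refine Finset.sum_eq_zero fun σ hσ => ?_
    simp only [Finset.mem_filter, Finset.mem_univ, true_and] at hσ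
    obtain ⟨P, S, hPS⟩ := exists_tupleProd_eq x a (b ∘ σ) r hr
    have hne (i : Fin t) (h1 : i.val ≠ r) (h2 : i.val ≠ r + 1) :=
      Equiv.swap_apply_of_ne_of_ne (a := (⟨r, Nat.lt_of_succ_lt hr⟩ : Fin t)) (b := ⟨r + 1, hr⟩)
        (Fin.ne_of_val_ne h1) (Fin.ne_of_val_ne h2)
    rw [hPS _ _ (fun _ _ _ => rfl) fun _ _ _ => rfl, hPS a _ (fun _ _ _ => rfl) fun i h1 h2 => by
      rw [Function.comp_apply, Equiv.Perm.mul_apply, hne i h1 h2]; rfl]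
    simp only [Function.comp_apply, Equiv.Perm.mul_apply, Equiv.swap_apply_left,
      Equiv.swap_apply_right, h]
    rw [hx.row _ _ _ (hb hσ)]
    simp
  swap a r hr h := by
    rw [rowMinor_eq_sum_ascents x a b r hr, rowMinor_eq_sum_ascents x _ b r hr, Finset.smul_sum]
    refine Finset.sum_congr rfl fun σ hσ => ?_
    simp only [Finset.mem_filter, Finset.mem_univ, true_and] at hσ
    obtain ⟨P, S, hPS⟩ := exists_tupleProd_eq x a (b ∘ σ) r hr
    have hne (i : Fin t) (h1 : i.val ≠ r) (h2 : i.val ≠ r + 1) :=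
      Equiv.swap_apply_of_ne_of_ne (a := (⟨r, Nat.lt_of_succ_lt hr⟩ : Fin t)) (b := ⟨r + 1, hr⟩)
        (Fin.ne_of_val_ne h1) (Fin.ne_of_val_ne h2)
    have ha (i : Fin t) (h1 : i.val ≠ r) (h2 : i.val ≠ r + 1) :
        (a ∘ Equiv.swap ⟨r, Nat.lt_of_succ_lt hr⟩ ⟨r + 1, hr⟩) i = a i := by
      rw [Function.comp_apply, hne i h1 h2]
    have hb' (i : Fin t) (h1 : i.val ≠ r) (h2 : i.val ≠ r + 1) :
        (b ∘ (σ * Equiv.swap ⟨r, Nat.lt_of_succ_lt hr⟩ ⟨r + 1, hr⟩ : Equiv.Perm (Fin t))) i =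
          (b ∘ σ) i := by
      rw [Function.comp_apply, Equiv.Perm.mul_apply, hne i h1 h2]; rfl
    rw [hPS a _ (fun _ _ _ => rfl) fun _ _ _ => rfl, hPS a _ (fun _ _ _ => rfl) hb',
      hPS _ _ ha fun _ _ _ => rfl, hPS _ _ ha hb']
    simp only [Function.comp_apply, Equiv.Perm.mul_apply, Equiv.swap_apply_left,
      Equiv.swap_apply_right]
    generalize a ⟨r, Nat.lt_of_succ_lt hr⟩ = i at h ⊢
    generalize a ⟨r + 1, hr⟩ = k at h ⊢
    have hjl := hb hσ
    generalize b (σ ⟨r, Nat.lt_of_succ_lt hr⟩) = j at hjl ⊢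
    generalize b (σ ⟨r + 1, hr⟩) = l at hjl ⊢
    -- After pairing permutations that differ by the adjacent transposition, everything reduces to
    -- this `2 × 2` identity, framed by the common factors `P` and `S`.
    have e : x k j * x i l - q • (x k l * x i j) = (-q) • (x i j * x k l - q • (x i l * x k j)) := by
      have h1 := hx.anti k i j l h hjl
      have h2 := hx.diag i k j l h hjl
      rw [h1, ← sub_sub_cancel (x i j * x k l) (x k l * x i j), h2]
      match_scalars <;> field_simp
      ring
    have e' : P * (x k j * x i l) * S - q • (P * (x k l * x i j) * S) =
        (-q) • (P * (x i j * x k l) * S - q • (P * (x i l * x k j) * S)) := by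
      have := congrArg (fun y => P * y * S) e
      simpa only [mul_sub, sub_mul, mul_smul_comm, smul_mul_assoc] using this
    rw [e', smul_comm]

theorem IsQuantum.rowMinor_comp_perm (hx : IsQuantum q x) (hq : q ≠ 0) {a : Fin t → Fin m}
    {b : Fin t → Fin n} (ha : StrictMono a) (hb : StrictMono b) (σ : Equiv.Perm (Fin t)) :
    rowMinor q x (a ∘ σ) b = (-q) ^ permLength σ • rowMinor q x a b :=
  (hx.rowMinor_qAlternating hq hb).comp_perm ha σ

theorem tupleProd_transpose (x : Matrix (Fin m) (Fin n) A) (a : Fin t → Fin m) (b : Fin t → Fin n) :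
    tupleProd x.transpose b a = tupleProd x a b := rfl

/-- Quantum minors are invariant under transposition. -/
theorem IsQuantum.rowMinor_transpose (hx : IsQuantum q x) (hq : ∀ r : ℕ, 0 < r → q ^ r ≠ 1)
    (hq0 : q ≠ 0) {a : Fin t → Fin m} {b : Fin t → Fin n} (ha : StrictMono a) (hb : StrictMono b) :
    rowMinor q x.transpose b a = rowMinor q x a b := by
  -- The sum over permutations of both rows and columns is symmetric under transposition, while row
  -- alternation evaluates it as a nonzero scalar, the Poincaré polynomial at `q ^ 2`, times the
  -- minor. Comparing it for `x` and for the transpose and cancelling the scalar gives the claim.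
  have key : ∀ {m n : ℕ} {x : Matrix (Fin m) (Fin n) A} (_ : IsQuantum q x) {a : Fin t → Fin m}
      {b : Fin t → Fin n} (_ : StrictMono a) (_ : StrictMono b),
      ∑ σ : Equiv.Perm (Fin t), ∑ τ : Equiv.Perm (Fin t), ((-q) ^ permLength σ * (-q) ^ permLength τ) •
        tupleProd x (a ∘ σ) (b ∘ τ) =
      (∑ σ : Equiv.Perm (Fin t), (-q) ^ permLength σ * (-q) ^ permLength σ) • rowMinor q x a b := by
    intro m n x hx a b ha hb
    rw [Finset.sum_smul]
    refine Finset.sum_congr rfl fun σ _ => ?_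
    rw [mul_smul, ← hx.rowMinor_comp_perm hq0 ha hb, rowMinor, Finset.smul_sum]
    simp_rw [mul_smul]
  have h1 := key hx ha hb
  have h2 := key hx.transpose hb ha
  refine (smul_right_injective A (sum_pow_permLength_ne_zero hq t) (h1.symm.trans (Eq.trans ?_ h2))).symm
  rw [Finset.sum_comm]
  refine Finset.sum_congr rfl fun σ _ => Finset.sum_congr rfl fun τ _ => ?_
  rw [mul_comm, tupleProd_transpose]

theorem tupleProd_append {s : ℕ} (x : Matrix (Fin m) (Fin n) A) (a : Fin s → Fin m) (a' : Fin t → Fin m)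
    (b : Fin s → Fin n) (b' : Fin t → Fin n) :
    tupleProd x (Fin.append a a') (Fin.append b b') = tupleProd x a b * tupleProd x a' b' := by
  simp [tupleProd, List.ofFn_add, List.prod_append, Fin.append_right]

/-- Only complementary pairs of column sets survive, since any other concatenation has a repeated
entry and sign zero. -/
theorem sum_tupleSign_smul_tupleProd_append {s : ℕ} (x : Matrix (Fin m) (Fin n) A) (a : Fin s → Fin m)
    (a' : Fin t → Fin m) (hn : s + t = n) :
    ∑ c, tupleSign q c • tupleProd x (Fin.append a a') c =
      ∑ J : {J : Finset (Fin n) // J.card = t}, complSign q hn J •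
        (rowMinor q x a (enum (complSet hn J)) * rowMinor q x a' (enum J)) := by
  rw [sum_append_tuples, Finset.sum_comm]
  refine Finset.sum_congr rfl fun J _ => ?_
  simp_rw [tupleSign_append_enum q hn, ite_smul, zero_smul]
  rw [Finset.sum_ite_eq' _ (complSet hn J)]
  simp only [Finset.mem_univ, if_true]
  congr 1
  simp_rw [rowMinor, Finset.sum_mul, Finset.mul_sum, tupleProd_append, smul_mul_smul_comm]

/-- The quantum determinant of a square matrix. -/
noncomputable def qdet (q : K) (x : Matrix (Fin n) (Fin n) A) : A :=
  rowMinor q x id id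

theorem qdet_transpose {x : Matrix (Fin n) (Fin n) A} (hx : IsQuantum q x)
    (hq : ∀ r : ℕ, 0 < r → q ^ r ≠ 1) (hq0 : q ≠ 0) : qdet q x.transpose = qdet q x :=
  hx.rowMinor_transpose hq hq0 strictMono_id strictMono_id

/-- Both sides are `q`-alternating in the row tuple `c`: a repeated row kills them, and a
permutation of the rows contributes its sign to each. -/
theorem IsQuantum.sum_tupleSign_smul {x : Matrix (Fin n) (Fin n) A} (hx : IsQuantum q x) (hq0 : q ≠ 0)
    {s : ℕ} (hn : s + t = n) (c : Fin (s + t) → Fin n) :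
    ∑ d, tupleSign q d • tupleProd x c d = tupleSign q c • qdet q x := by
  subst hn
  rw [← sum_perm_eq_sum_tuples]
  have h : ∑ σ : Equiv.Perm (Fin (s + t)), (-q) ^ permLength σ • tupleProd x c σ = rowMinor q x c id :=
    rfl
  rw [h]
  have hf := hx.rowMinor_qAlternating hq0 (b := id) strictMono_id
  by_cases hc : Function.Injective c
  · let σ := Equiv.ofBijective c (Finite.injective_iff_bijective.1 hc)
    have h1 := hf.comp_perm strictMono_id σ
    have h2 := (tupleSign_qAlternating q (s + t) (s + t)).comp_perm strictMono_id σ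
    rw [tupleSign_strictMono q strictMono_id, smul_eq_mul, mul_one] at h2
    have h3 : id ∘ σ = c := rfl
    rw [h3] at h1 h2
    rw [h1, h2]
    rfl
  · rw [tupleSign_of_not_injective q hc, zero_smul]
    exact hf.eq_zero_of_not_injective hc

/-- Laplace expansion of the quantum determinant along complementary sets of rows. -/
theorem IsQuantum.laplace {x : Matrix (Fin n) (Fin n) A} (hx : IsQuantum q x) (hq0 : q ≠ 0)
    {s : ℕ} (hn : s + t = n) (I I' : {J : Finset (Fin n) // J.card = t}) :
    ∑ J, complSign q hn J •
        (rowMinor q x (enum (complSet hn I)) (enum (complSet hn J)) * rowMinor q x (enum I') (enum J)) =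
      if I = I' then complSign q hn I • qdet q x else 0 := by
  rw [← sum_tupleSign_smul_tupleProd_append, hx.sum_tupleSign_smul hq0 hn,
    tupleSign_append_enum q hn]
  have : complSet hn I = complSet hn I' ↔ I = I' := by
    simp [complSet, Subtype.ext_iff]
  simp only [this, ite_smul, zero_smul]
  split_ifs with h
  · rw [h]
  · rfl

end Minor

/-! ### The quantum adjugate -/

theorem sum_enum_add_sum_enum_compl {s t n : ℕ} (hn : s + t = n)
    (J : {J : Finset (Fin n) // J.card = t}) :
    ∑ p, (enum (complSet hn J) p).val + ∑ p, (enum J p).val = ∑ a : Fin n, a.val := by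
  have h := (injective_append_enum_iff hn _ J).2 rfl
  have hb : Function.Bijective (Fin.append (enum (complSet hn J)) (enum J)) :=
    (Fintype.bijective_iff_injective_and_card _).2 ⟨h, by simp [hn]⟩
  have := hb.sum_comp fun a => a.val
  rw [Fin.sum_univ_add] at this
  simpa only [Fin.append_left, Fin.append_right] using this

theorem complSet_complSet {s t n : ℕ} (hn : s + t = n) (hn' : t + s = n)
    (J : {J : Finset (Fin n) // J.card = t}) : complSet hn' (complSet hn J) = J :=
  Subtype.ext (compl_compl J.1)

/-- The exponents contributed by a set and its complement add up to a constant, as their element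
sums add up to the sum of all indices. This makes the left and right Laplace expansions produce the
same adjugate. -/
theorem complSign_compl_mul {K : Type*} [Field K] {q : K} (hq : q ≠ 0) {s t n : ℕ} (hn : s + t = n)
    (hn' : t + s = n) (J J' : {J : Finset (Fin n) // J.card = t}) :
    complSign q hn' (complSet hn J) * complSign q hn J =
      complSign q hn' (complSet hn J') * complSign q hn J' := by
  have h (J : {J : Finset (Fin n) // J.card = t}) :
      complSign q hn' (complSet hn J) * complSign q hn J * (-q) ^ ∑ a : Fin n, a.val =
        (-q) ^ (∑ p : Fin s, (t + p.val)) * (-q) ^ ∑ p : Fin t, (s + p.val) := by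
    rw [← complSign_mul_pow q hn J, ← complSign_mul_pow q hn' (complSet hn J),
      ← sum_enum_add_sum_enum_compl hn J, pow_add]
    ring
  exact mul_right_cancel₀ (pow_ne_zero _ (neg_ne_zero.2 hq)) ((h J).trans (h J').symm)

section Adjugate

variable {K : Type*} [Field K] {q : K} {A : Type*} [Ring A] [Algebra K A] {n : ℕ}

/-- The signed complementary minor: the entry at `(J, I)` of the adjugate of the matrix of all minors
of a given size. -/
noncomputable def complMinor (q : K) (x : Matrix (Fin n) (Fin n) A) {s t : ℕ} (hn : s + t = n)
    (J I : {J : Finset (Fin n) // J.card = t}) : A :=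
  (complSign q hn I * (complSign q hn J)⁻¹) •
    rowMinor q x (enum (complSet hn I)) (enum (complSet hn J))

variable {x : Matrix (Fin n) (Fin n) A}

/-- Laplace expansion of the transposed matrix, read back through the invariance of minors under
transposition. -/
theorem IsQuantum.sum_complMinor_mul (hx : IsQuantum q x) (hq : ∀ r : ℕ, 0 < r → q ^ r ≠ 1)
    (hq0 : q ≠ 0) {s t : ℕ} (hn : s + t = n) (I I' : {J : Finset (Fin n) // J.card = t}) :
    ∑ J, complMinor q x hn I J * rowMinor q x (enum J) (enum I') =
      if I = I' then qdet q x else 0 := by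
  have h := hx.transpose.laplace hq0 hn I I'
  rw [qdet_transpose hx hq hq0] at h
  simp_rw [hx.rowMinor_transpose hq hq0 (enum_strictMono _) (enum_strictMono _)] at h
  have h' := congrArg (fun z => (complSign q hn I)⁻¹ • z) h
  simp only [Finset.smul_sum, smul_ite, smul_zero, smul_smul,
    inv_mul_cancel₀ (complSign_ne_zero hq0 hn I), one_smul] at h'
  rw [← h']
  refine Finset.sum_congr rfl fun J _ => ?_
  rw [complMinor, smul_mul_assoc, mul_comm]

/-- Laplace expansion with the two block sizes interchanged, so that the `t`-minors stand on the
left; `complSign_compl_mul` reconciles the signs. -/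
theorem IsQuantum.sum_mul_complMinor (hx : IsQuantum q x) (hq0 : q ≠ 0) {s t : ℕ} (hn : s + t = n)
    (I I' : {J : Finset (Fin n) // J.card = t}) :
    ∑ J, rowMinor q x (enum I) (enum J) * complMinor q x hn J I' =
      if I = I' then qdet q x else 0 := by
  have hn' : t + s = n := by omega
  have h := hx.laplace hq0 hn' (complSet hn I) (complSet hn I')
  let e : {J : Finset (Fin n) // J.card = t} ≃ {J : Finset (Fin n) // J.card = s} :=
    ⟨complSet hn, complSet hn', complSet_complSet hn hn', complSet_complSet hn' hn⟩
  rw [← e.sum_comp] at h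
  have hinj : complSet hn I = complSet hn I' ↔ I = I' := e.injective.eq_iff
  simp only [e, Equiv.coe_fn_mk, complSet_complSet hn hn', hinj] at h
  have hne := complSign_ne_zero hq0 hn' (complSet hn I')
  have h' := congrArg (fun z => (complSign q hn' (complSet hn I'))⁻¹ • z) h
  simp only [Finset.smul_sum, smul_ite, smul_zero, smul_smul] at h'
  convert h' using 1
  · refine Finset.sum_congr rfl fun J _ => ?_
    rw [complMinor, mul_smul_comm]
    congr 1
    have h1 := complSign_compl_mul hq0 hn hn' J I'
    have h2 := complSign_ne_zero hq0 hn J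
    field_simp
    rw [mul_comm, ← h1, mul_comm]
  · split_ifs with hI
    · rw [hI, inv_mul_cancel₀ hne, one_smul]
    · rfl

theorem rowMinor_singleton (x : Matrix (Fin n) (Fin n) A) (i j : Fin n) :
    rowMinor q x (enum ⟨{i}, Finset.card_singleton i⟩) (enum ⟨{j}, Finset.card_singleton j⟩) = x i j := by
  have h4 (σ : Equiv.Perm (Fin 1)) : permLength σ = 0 := by
    simp [permLength, Subsingleton.elim _ (0 : Fin 1)]
  simp [rowMinor, h4, tupleProd, enum_singleton]

/-- The adjugate of a quantum matrix. -/
noncomputable def qadj (q : K) (x : Matrix (Fin n) (Fin n) A) {s : ℕ} (hn : s + 1 = n) :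
    Matrix (Fin n) (Fin n) A := fun j i =>
  complMinor q x hn ⟨{j}, Finset.card_singleton j⟩ ⟨{i}, Finset.card_singleton i⟩

theorem IsQuantum.mul_qadj (hx : IsQuantum q x) (hq0 : q ≠ 0) {s : ℕ} (hn : s + 1 = n) :
    x * qadj q x hn = Matrix.diagonal fun _ => qdet q x := by
  ext i k
  have h := hx.sum_mul_complMinor hq0 hn ⟨{i}, Finset.card_singleton i⟩ ⟨{k}, Finset.card_singleton k⟩
  rw [sum_subsets_card_one] at h
  simp only [rowMinor_singleton, Subtype.mk.injEq, Finset.singleton_inj] at h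
  rw [Matrix.diagonal_apply, ← h, Matrix.mul_apply]
  rfl

theorem IsQuantum.qadj_mul (hx : IsQuantum q x) (hq : ∀ r : ℕ, 0 < r → q ^ r ≠ 1) (hq0 : q ≠ 0)
    {s : ℕ} (hn : s + 1 = n) : qadj q x hn * x = Matrix.diagonal fun _ => qdet q x := by
  ext i k
  have h := hx.sum_complMinor_mul hq hq0 hn ⟨{i}, Finset.card_singleton i⟩
    ⟨{k}, Finset.card_singleton k⟩
  rw [sum_subsets_card_one] at h
  simp only [rowMinor_singleton, Subtype.mk.injEq, Finset.singleton_inj] at h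
  rw [Matrix.diagonal_apply, ← h, Matrix.mul_apply]
  rfl

end Adjugate

/-! ### The quantum relations as commutation with a Hecke operator -/

section Hecke

variable {K : Type*} [Field K] (q : K) {A : Type*} [Ring A] [Algebra K A] {n : ℕ}

/-- The diagonal coefficients of the Hecke operator. -/
def heckeDiag (i h : Fin n) : K := if i = h then q else if i < h then q - q⁻¹ else 0

/-- The off-diagonal coefficients of the Hecke operator. -/
def heckeSwap (K : Type*) [Field K] {n : ℕ} (i h : Fin n) : K := if i = h then 0 else 1

/-- The Hecke operator on the tensor square, as a matrix. -/
def heckeMatrix (A : Type*) [Ring A] [Algebra K A] (n : ℕ) :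
    Matrix (Fin n × Fin n) (Fin n × Fin n) A :=
  Matrix.diagonal (fun p => algebraMap K A (heckeDiag q p.1 p.2)) +
    Matrix.of fun p p' => if p' = p.swap then algebraMap K A (heckeSwap K p.1 p.2) else 0

theorem heckeMatrix_mul_apply (T : Matrix (Fin n × Fin n) (Fin n × Fin n) A) (i h : Fin n)
    (p : Fin n × Fin n) : (heckeMatrix q A n * T) (i, h) p =
      heckeDiag q i h • T (i, h) p + heckeSwap K i h • T (h, i) p := by
  rw [heckeMatrix, add_mul, Matrix.add_apply, Matrix.diagonal_mul, Matrix.mul_apply]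
  simp [Algebra.smul_def]

theorem mul_heckeMatrix_apply (T : Matrix (Fin n × Fin n) (Fin n × Fin n) A) (p : Fin n × Fin n)
    (j l : Fin n) : (T * heckeMatrix q A n) p (j, l) =
      heckeDiag q j l • T p (j, l) + heckeSwap K j l • T p (l, j) := by
  have h (p' : Fin n × Fin n) : (j, l) = p'.swap ↔ p' = (l, j) := by
    rw [← Prod.swap_inj, Prod.swap_swap]
    exact eq_comm
  rw [heckeMatrix, mul_add, Matrix.add_apply, Matrix.mul_diagonal, Matrix.mul_apply]
  simp only [Matrix.of_apply, h, mul_ite, mul_zero, Finset.sum_ite_eq', Finset.mem_univ, if_true]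
  simp only [heckeSwap, eq_comm (a := l), Algebra.smul_def, Algebra.commutes]

/-- The tensor square of a matrix. -/
def tensorSq (x : Matrix (Fin n) (Fin n) A) : Matrix (Fin n × Fin n) (Fin n × Fin n) A :=
  fun p p' => x p.1 p'.1 * x p.2 p'.2

theorem heckeDiag_self (i : Fin n) : heckeDiag q i i = q := by simp [heckeDiag]

theorem heckeDiag_lt {i h : Fin n} (hi : i < h) : heckeDiag q i h = q - q⁻¹ := by
  simp [heckeDiag, hi, hi.ne]

theorem heckeDiag_gt {i h : Fin n} (hi : h < i) : heckeDiag q i h = 0 := by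
  simp [heckeDiag, hi.not_gt, hi.ne']

theorem heckeSwap_self (i : Fin n) : heckeSwap K i i = 0 := by simp [heckeSwap]

theorem heckeSwap_ne {i h : Fin n} (hi : i ≠ h) : heckeSwap K i h = 1 := by
  simp [heckeSwap, hi]

/-- The relations of quantum matrices say that the tensor square commutes with the Hecke operator. -/
theorem isQuantum_iff_hecke {q : K} (hq0 : q ≠ 0) (x : Matrix (Fin n) (Fin n) A) :
    IsQuantum q x ↔ ∀ i h j l,
      heckeDiag q i h • (x i j * x h l) + heckeSwap K i h • (x h j * x i l) =
        heckeDiag q j l • (x i j * x h l) + heckeSwap K j l • (x i l * x h j) := by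
  constructor
  · intro hx i h j l
    rcases lt_trichotomy i h with hi | rfl | hi <;> rcases lt_trichotomy j l with hj | rfl | hj
    · rw [heckeDiag_lt q hi, heckeDiag_lt q hj, heckeSwap_ne hi.ne, heckeSwap_ne hj.ne,
        hx.anti h i j l hi hj]
    · rw [heckeDiag_lt q hi, heckeDiag_self, heckeSwap_ne hi.ne, heckeSwap_self, hx.col i h j hi]
      match_scalars
      field_simp
      ring
    · rw [heckeDiag_lt q hi, heckeDiag_gt q hj, heckeSwap_ne hi.ne, heckeSwap_ne hj.ne',
        ← hx.diag i h l j hi hj]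
      module
    · rw [heckeDiag_self, heckeDiag_lt q hj, heckeSwap_self, heckeSwap_ne hj.ne, hx.row i j l hj]
      match_scalars
      field_simp
      ring
    · simp only [heckeDiag_self, heckeSwap_self]
    · rw [heckeDiag_self, heckeDiag_gt q hj, heckeSwap_self, heckeSwap_ne hj.ne', hx.row i l j hj]
      module
    · rw [heckeDiag_gt q hi, heckeDiag_lt q hj, heckeSwap_ne hi.ne', heckeSwap_ne hj.ne,
        hx.anti i h j l hi hj, ← hx.diag h i j l hi hj]
      module
    · rw [heckeDiag_gt q hi, heckeDiag_self, heckeSwap_ne hi.ne', heckeSwap_self, hx.col h i j hi]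
      module
    · rw [heckeDiag_gt q hi, heckeDiag_gt q hj, heckeSwap_ne hi.ne', heckeSwap_ne hj.ne',
        hx.anti i h l j hi hj]
  · intro H
    refine ⟨fun i j l hj => ?_, fun i h j hi => ?_, fun i h j l hi hj => ?_, fun i h j l hi hj => ?_⟩
    · have := H i i l j
      rw [heckeDiag_self, heckeDiag_gt q hj, heckeSwap_self, heckeSwap_ne hj.ne'] at this
      simpa using this.symm
    · have := H h i j j
      rw [heckeDiag_self, heckeDiag_gt q hi, heckeSwap_self, heckeSwap_ne hi.ne'] at this
      simpa using this
    · have := H i h l j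
      rw [heckeDiag_gt q hi, heckeDiag_gt q hj, heckeSwap_ne hi.ne', heckeSwap_ne hj.ne'] at this
      simpa using this.symm
    · have := H i h l j
      rw [heckeDiag_lt q hi, heckeDiag_gt q hj, heckeSwap_ne hi.ne, heckeSwap_ne hj.ne'] at this
      simp only [one_smul, zero_smul, zero_add] at this
      rw [← this]
      exact add_sub_cancel_right _ _

end Hecke

/-! ### Inverses up to a scalar factor and the quantum Jacobi identity -/

section Inverse

variable {K : Type*} [Field K] {q : K} {A : Type*} [Ring A] [Algebra K A] {n : ℕ}
  {x y : Matrix (Fin n) (Fin n) A} {d : A}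

/-- Compare the two bracketings of `x * y * x`. Applied to the adjugate, this proves that the
quantum determinant is central. -/
theorem commute_of_mul_eq_diagonal (hxy : x * y = Matrix.diagonal fun _ => d)
    (hyx : y * x = Matrix.diagonal fun _ => d) (i j : Fin n) : Commute d (x i j) := by
  have h : x * y * x = x * (y * x) := mul_assoc _ _ _
  rw [hxy, hyx] at h
  have := congrFun (congrFun h i) j
  rwa [Matrix.diagonal_mul, Matrix.mul_diagonal] at this

theorem commute_rowMinor (hd : ∀ i j, Commute d (x i j)) {t : ℕ} (a b : Fin t → Fin n) :
    Commute d (rowMinor q x a b) := by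
  refine Commute.sum_right _ _ _ fun σ _ => Commute.smul_right (Commute.list_prod_right _ _ ?_) _
  intro z hz
  obtain ⟨i, rfl⟩ := List.mem_ofFn.1 hz
  exact hd _ _

theorem sum_mul_eq_of_mul_eq_diagonal (hxy : x * y = Matrix.diagonal fun _ => d) (i k : Fin n) :
    ∑ j, x i j * y j k = if i = k then d else 0 := by
  rw [← Matrix.mul_apply, hxy, Matrix.diagonal_apply]

/-- The matrix of opposites of the entries. -/
def opMatrix (y : Matrix (Fin n) (Fin n) A) : Matrix (Fin n) (Fin n) Aᵐᵒᵖ :=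
  fun i j => MulOpposite.op (y i j)

/-- An inverse, up to a central regular factor, of a quantum matrix is a quantum matrix over the
opposite algebra. -/
theorem IsQuantum.opMatrix_of_mul_eq_diagonal (hx : IsQuantum q x) (hq0 : q ≠ 0)
    (hxy : x * y = Matrix.diagonal fun _ => d) (hyx : y * x = Matrix.diagonal fun _ => d)
    (hd : ∀ a : A, d * a = 0 → a = 0) : IsQuantum q (opMatrix y) := by
  have hdx := commute_of_mul_eq_diagonal hxy hyx
  have hdy := commute_of_mul_eq_diagonal hyx hxy
  set T := tensorSq x with hT
  -- This is the tensor square of `y` formed with the opposite multiplication. In this order the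
  -- products with `T` telescope to `d * d`.
  set T' : Matrix (Fin n × Fin n) (Fin n × Fin n) A := fun p p' => y p.2 p'.2 * y p.1 p'.1 with hT'
  set D : Matrix (Fin n × Fin n) (Fin n × Fin n) A := Matrix.diagonal fun _ => d * d with hD
  have h1 : T * T' = D := by
    ext ⟨i, h⟩ ⟨a, b⟩
    have e : ∀ j, ∑ l, x i j * x h l * (y l b * y j a) = if h = b then x i j * y j a * d else 0 := by
      intro j
      have := congrArg (fun z => x i j * z * y j a) (sum_mul_eq_of_mul_eq_diagonal hxy h b)
      simp only [Finset.mul_sum, Finset.sum_mul] at this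
      simp only [← mul_assoc] at this ⊢
      rw [this]
      split_ifs
      · rw [mul_assoc, (hdy j a).eq, ← mul_assoc]
      · simp
    rw [Matrix.mul_apply, Fintype.sum_prod_type]
    simp only [hT, hT', tensorSq, e]
    rw [hD, Matrix.diagonal_apply]
    by_cases hb : h = b
    · simp only [hb, if_true, ← Finset.sum_mul, sum_mul_eq_of_mul_eq_diagonal hxy i a]
      simp [Prod.ext_iff]
    · simp [hb, Prod.ext_iff]
  have h2 : T' * T = D := by
    ext ⟨i, h⟩ ⟨a, b⟩
    have e : ∀ l, ∑ j, y h l * y i j * (x j a * x l b) = if i = a then y h l * x l b * d else 0 := by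
      intro l
      have := congrArg (fun z => y h l * z * x l b) (sum_mul_eq_of_mul_eq_diagonal hyx i a)
      simp only [Finset.mul_sum, Finset.sum_mul] at this
      simp only [← mul_assoc] at this ⊢
      rw [this]
      split_ifs
      · rw [mul_assoc, (hdx l b).eq, ← mul_assoc]
      · simp
    rw [Matrix.mul_apply, Fintype.sum_prod_type, Finset.sum_comm]
    simp only [hT, hT', tensorSq, e]
    rw [hD, Matrix.diagonal_apply]
    by_cases hb : i = a
    · simp only [hb, if_true, ← Finset.sum_mul, sum_mul_eq_of_mul_eq_diagonal hyx h b]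
      simp [Prod.ext_iff]
    · simp [hb, Prod.ext_iff]
  have hR : heckeMatrix q A n * T = T * heckeMatrix q A n := by
    ext ⟨i, h⟩ ⟨j, l⟩
    rw [heckeMatrix_mul_apply, mul_heckeMatrix_apply]
    exact (isQuantum_iff_hecke hq0 x).1 hx i h j l
  -- With `R` the Hecke matrix, `T' R D = T' R T T' = T' T R T' = D R T'`: commutation with `R`
  -- passes to the inverse, up to the factor `d * d`, which is cancelled entrywise below.
  have h3 : T' * heckeMatrix q A n * D = D * (heckeMatrix q A n * T') := by
    rw [← h1, mul_assoc T', ← mul_assoc _ T T', hR, h1, ← h2]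
    simp only [mul_assoc]
  rw [isQuantum_iff_hecke hq0]
  intro i h j l
  have h4 := congrFun (congrFun h3 (i, h)) (j, l)
  rw [hD, Matrix.mul_diagonal, Matrix.diagonal_mul, mul_heckeMatrix_apply, heckeMatrix_mul_apply] at h4
  have hc (u v w z : Fin n) : Commute (d * d) (T' (u, v) (w, z)) :=
    (((hdy _ _).mul_right (hdy _ _)).mul_left ((hdy _ _).mul_right (hdy _ _)))
  have hcc : Commute (d * d) (heckeDiag q j l • T' (i, h) (j, l) + heckeSwap K j l • T' (i, h) (l, j)) :=
    ((hc _ _ _ _).smul_right _).add_right ((hc _ _ _ _).smul_right _)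
  rw [← hcc.eq, ← sub_eq_zero, ← mul_sub, mul_assoc] at h4
  have h5 := sub_eq_zero.1 (hd _ (hd _ h4))
  exact congrArg MulOpposite.op h5.symm

/-- The opposite product reverses the factors from `y`, so the sums nest as `x (⋯) y` and collapse
from the inside, each level giving a factor `d` or zero. -/
theorem sum_tupleProd_mul (hxy : x * y = Matrix.diagonal fun _ => d)
    (hyx : y * x = Matrix.diagonal fun _ => d) : ∀ {t : ℕ} (i b : Fin t → Fin n),
    ∑ a, tupleProd x i a * (tupleProd (opMatrix y) a b).unop = if i = b then d ^ t else 0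
  | 0, i, b => by
    rw [if_pos (Subsingleton.elim i b), Finset.univ_unique, Finset.sum_singleton]
    simp [tupleProd]
  | t + 1, i, b => by
    rw [← (Fin.consEquiv fun _ : Fin (t + 1) => Fin n).sum_comp, Fintype.sum_prod_type]
    have e (a₀ : Fin n) (a : Fin t → Fin n) :
        tupleProd x i (Fin.consEquiv (fun _ : Fin (t + 1) => Fin n) (a₀, a)) *
          (tupleProd (opMatrix y) (Fin.consEquiv (fun _ : Fin (t + 1) => Fin n) (a₀, a)) b).unop =
        x (i 0) a₀ * (tupleProd x (fun p => i p.succ) a *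
          (tupleProd (opMatrix y) a fun p => b p.succ).unop) * y a₀ (b 0) := by
      simp [tupleProd, List.ofFn_succ, Fin.consEquiv, opMatrix, mul_assoc]
    simp_rw [e, ← Finset.sum_mul, ← Finset.mul_sum, sum_tupleProd_mul hxy hyx]
    have hdy := commute_of_mul_eq_diagonal hyx hxy
    have hib : i = b ↔ i 0 = b 0 ∧ (fun p : Fin t => i p.succ) = fun p => b p.succ := by
      refine ⟨fun h => by simp [h], fun ⟨h1, h2⟩ => funext fun p => ?_⟩
      exact Fin.cases h1 (fun p => congrFun h2 p) p
    by_cases hs : (fun p : Fin t => i p.succ) = fun p => b p.succ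
    · simp only [hs, if_true, hib, and_true, mul_assoc, ((hdy _ _).pow_left t).eq]
      simp only [← mul_assoc, ← Finset.sum_mul, sum_mul_eq_of_mul_eq_diagonal hxy, ite_mul, zero_mul,
        pow_succ']
    · simp [hs, hib]

/-- The matrix of minors of an inverse is inverse to the matrix of minors. -/
theorem sum_rowMinor_mul_unop_rowMinor (hx : IsQuantum q x) (hq0 : q ≠ 0)
    (hxy : x * y = Matrix.diagonal fun _ => d) (hyx : y * x = Matrix.diagonal fun _ => d)
    (hd : ∀ a : A, d * a = 0 → a = 0) {t : ℕ} (I I' : {J : Finset (Fin n) // J.card = t}) :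
    ∑ J, rowMinor q x (enum I) (enum J) * (rowMinor q (opMatrix y) (enum J) (enum I')).unop =
      if I = I' then d ^ t else 0 := by
  have hy := (hx.opMatrix_of_mul_eq_diagonal hq0 hxy hyx hd).rowMinor_qAlternating hq0 (t := t)
    (enum_strictMono I')
  trans ∑ a, tupleProd x (enum I) a * (rowMinor q (opMatrix y) a (enum I')).unop
  · rw [sum_tuples]
    · refine Finset.sum_congr rfl fun J _ => ?_
      rw [rowMinor, Finset.sum_mul]
      refine Finset.sum_congr rfl fun σ _ => ?_
      rw [hy.comp_perm (enum_strictMono J) σ, MulOpposite.unop_smul, smul_mul_assoc, mul_smul_comm]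
    · intro a ha
      rw [hy.eq_zero_of_not_injective ha, MulOpposite.unop_zero, mul_zero]
  · simp only [rowMinor, Finset.unop_sum, MulOpposite.unop_smul, Finset.mul_sum, mul_smul_comm]
    rw [Finset.sum_comm]
    simp_rw [← Finset.smul_sum, sum_tupleProd_mul hxy hyx]
    have h (σ : Equiv.Perm (Fin t)) : enum I = enum I' ∘ σ ↔ I = I' ∧ σ = 1 := by
      refine ⟨fun h => ?_, fun ⟨h1, h2⟩ => by rw [h1, h2]; rfl⟩
      have := enum_comp_perm_injective (J := I) (J' := I') (σ := 1) (σ' := σ) h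
      exact ⟨this.1, this.2.symm⟩
    by_cases hI : I = I'
    · have h1 : permLength (1 : Equiv.Perm (Fin t)) = 0 := tupleInv_strictMono strictMono_id
      rw [Finset.sum_eq_single 1]
      · simp [hI, h1]
      · intro σ _ hσ
        simp [h, hσ]
      · simp
    · simp [h, hI]

end Inverse

/-- Quantum Jacobi identity. The matrix of `(t + 1)`-minors of `x` has the complementary minors as
left inverse up to `d`, and the minors of the adjugate as right inverse up to `d ^ (t + 1)`.
Evaluating the triple product in two ways and cancelling one regular factor `d` compares the two. -/
theorem IsQuantum.unop_rowMinor_qadj {K : Type*} [Field K] {q : K} {A : Type*} [Ring A] [Algebra K A]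
    {n : ℕ} {x : Matrix (Fin n) (Fin n) A} (hx : IsQuantum q x)
    (hq : ∀ r : ℕ, 0 < r → q ^ r ≠ 1) (hq0 : q ≠ 0) (hd : ∀ a : A, qdet q x * a = 0 → a = 0)
    {r : ℕ} (hr : r + 1 = n) {s t : ℕ} (hn : s + (t + 1) = n)
    (I I' : {J : Finset (Fin n) // J.card = t + 1}) :
    (rowMinor q (opMatrix (qadj q x hr)) (enum I) (enum I')).unop =
      complMinor q x hn I I' * qdet q x ^ t := by
  have hxy := hx.mul_qadj hq0 hr
  have hyx := hx.qadj_mul hq hq0 hr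
  have hdx := commute_of_mul_eq_diagonal hxy hyx
  have h : qdet q x * (rowMinor q (opMatrix (qadj q x hr)) (enum I) (enum I')).unop =
      complMinor q x hn I I' * qdet q x ^ (t + 1) := by
    have h1 := sum_rowMinor_mul_unop_rowMinor hx hq0 hxy hyx hd (t := t + 1)
    have h2 : ∑ J, complMinor q x hn I J * ∑ J', rowMinor q x (enum J) (enum J') *
        (rowMinor q (opMatrix (qadj q x hr)) (enum J') (enum I')).unop =
        complMinor q x hn I I' * qdet q x ^ (t + 1) := by
      simp_rw [h1]
      simp
    rw [← h2]
    simp_rw [Finset.mul_sum]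
    rw [Finset.sum_comm]
    simp_rw [← mul_assoc, ← Finset.sum_mul, hx.sum_complMinor_mul hq hq0 hn]
    simp
  have hc : Commute (qdet q x) (complMinor q x hn I I') :=
    (commute_rowMinor hdx _ _).smul_right _
  rw [pow_succ', ← mul_assoc, ← hc.eq, mul_assoc, ← sub_eq_zero, ← mul_sub] at h
  exact sub_eq_zero.1 (hd _ h)

/-! ### A domain criterion through Ore extensions -/

section Ore

variable {K : Type*} [Field K] {A : Type*} [Ring A] [Algebra K A]

/-- Left multiplication by the variable of the Ore extension `A[X; σ, δ]`, on polynomials with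
coefficients written on the left. -/
noncomputable def oreOperator (σ : A →ₐ[K] A) (δ : A →ₗ[K] A) : Module.End K (Polynomial A) :=
  Polynomial.lsum fun i =>
    ((Polynomial.monomial (i + 1)).restrictScalars K).comp σ.toLinearMap +
      ((Polynomial.monomial i).restrictScalars K).comp δ

theorem oreOperator_monomial (σ : A →ₐ[K] A) (δ : A →ₗ[K] A) (i : ℕ) (a : A) :
    oreOperator σ δ (Polynomial.monomial i a) =
      Polynomial.monomial (i + 1) (σ a) + Polynomial.monomial i (δ a) := by
  simp [oreOperator, Polynomial.lsum_apply, Polynomial.sum_monomial_index]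

theorem oreOperator_C_mul {σ : A →ₐ[K] A} {δ : A →ₗ[K] A}
    (hδ : ∀ a b, δ (a * b) = σ a * δ b + δ a * b) (a : A) (f : Polynomial A) :
    oreOperator σ δ (Polynomial.C a * f) =
      Polynomial.C (σ a) * oreOperator σ δ f + Polynomial.C (δ a) * f := by
  induction f using Polynomial.induction_on' with
  | add f g hf hg =>
    rw [mul_add, map_add, hf, hg, map_add]
    noncomm_ring
  | monomial i b =>
    simp only [Polynomial.C_mul_monomial, oreOperator_monomial, hδ, map_mul, mul_add, map_add]
    abel

theorem coeff_oreOperator_succ (σ : A →ₐ[K] A) (δ : A →ₗ[K] A) (f : Polynomial A) (j : ℕ) :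
    (oreOperator σ δ f).coeff (j + 1) = σ (f.coeff j) + δ (f.coeff (j + 1)) := by
  induction f using Polynomial.induction_on' with
  | add f g hf hg =>
    simp only [map_add, Polynomial.coeff_add, hf, hg]
    abel
  | monomial i b =>
    rw [oreOperator_monomial]
    simp only [Polynomial.coeff_add, Polynomial.coeff_monomial, add_left_inj]
    split_ifs <;> simp

/-- Only the `σ` part of the operator raises the degree, so the top coefficient is governed by
powers of `σ` alone. -/
theorem coeff_oreOperator_pow (σ : A →ₐ[K] A) (δ : A →ₗ[K] A) (f : Polynomial A) (i : ℕ) :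
    (∀ j, f.natDegree + i < j → ((oreOperator σ δ ^ i) f).coeff j = 0) ∧
      ((oreOperator σ δ ^ i) f).coeff (f.natDegree + i) = (σ ^ i) f.leadingCoeff := by
  induction i with
  | zero => exact ⟨fun j hj => by simpa using Polynomial.coeff_eq_zero_of_natDegree_lt hj, by simp⟩
  | succ i ih =>
    obtain ⟨h1, h2⟩ := ih
    simp only [pow_succ', Module.End.mul_apply, AlgHom.mul_apply]
    refine ⟨fun j hj => ?_, ?_⟩
    · obtain ⟨j, rfl⟩ : ∃ j', j = j' + 1 := ⟨j - 1, by omega⟩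
      rw [coeff_oreOperator_succ, h1 _ (by omega), h1 _ (by omega), map_zero, map_zero, add_zero]
    · rw [← add_assoc, coeff_oreOperator_succ, h2, h1 _ (by omega), map_zero, add_zero]

variable {A' : Type*} [Ring A'] [Algebra K A']

/-- The sum `∑ aᵢ xⁱ`. -/
noncomputable def oreEval (inc : A →ₐ[K] A') (x : A') : Polynomial A →ₗ[K] A' :=
  Polynomial.lsum fun i => (LinearMap.mulRight K (x ^ i)).comp inc.toLinearMap

theorem oreEval_monomial (inc : A →ₐ[K] A') (x : A') (i : ℕ) (a : A) :
    oreEval inc x (Polynomial.monomial i a) = inc a * x ^ i := by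
  simp [oreEval, Polynomial.lsum_apply, Polynomial.sum_monomial_index]

/-- A ring generated by a domain `A` and an element `x` with `x a = σ(a) x + δ(a)` is a domain, as
soon as it acts on polynomials over `A` like the Ore extension. -/
theorem noZeroDivisors_of_ore [NoZeroDivisors A] {σ : A →ₐ[K] A} {δ : A →ₗ[K] A}
    (hσ : Function.Injective σ) (inc : A →ₐ[K] A') (x : A')
    (hx : ∀ a, x * inc a = inc (σ a) * x + inc (δ a))
    (hgen : Algebra.adjoin K (Set.range inc ∪ {x}) = ⊤)
    (act : A' →ₐ[K] Module.End K (Polynomial A))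
    (hact : ∀ a f, act (inc a) f = Polynomial.C a * f) (hactx : act x = oreOperator σ δ) :
    NoZeroDivisors A' := by
  -- Left multiplication corresponds to the action on polynomials. Evaluating at `1` shows that
  -- every element has a normal form `∑ aᵢ xⁱ`, recovered as `act g 1`.
  have hev (g : A') : ∀ f, g * oreEval inc x f = oreEval inc x (act g f) := by
    have hg : g ∈ Algebra.adjoin K (Set.range inc ∪ {x}) := by rw [hgen]; trivial
    induction hg using Algebra.adjoin_induction with
    | mem g hg =>
      intro f
      induction f using Polynomial.induction_on' with
      | add f f' hf hf' => rw [map_add, mul_add, hf, hf', map_add, map_add]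
      | monomial i b =>
        rcases hg with ⟨a, rfl⟩ | rfl
        · rw [hact, Polynomial.C_mul_monomial, oreEval_monomial, oreEval_monomial, map_mul, mul_assoc]
        · rw [hactx, oreOperator_monomial, map_add]
          simp only [oreEval_monomial]
          rw [← mul_assoc, hx, add_mul, pow_succ', mul_assoc]
    | algebraMap r => intro f; simp [Algebra.algebraMap_eq_smul_one]
    | add g g' _ _ h h' => intro f; rw [add_mul, h, h', map_add, LinearMap.add_apply, map_add]
    | mul g g' _ _ h h' => intro f; rw [mul_assoc, h', h, map_mul, Module.End.mul_apply]
  have hone : oreEval inc x 1 = 1 := by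
    rw [← Polynomial.monomial_zero_one, oreEval_monomial]
    simp
  have hinv (g : A') : g = oreEval inc x (act g 1) := by rw [← hev, hone, mul_one]
  have hact' (f g : Polynomial A) : act (oreEval inc x f) g =
      f.sum fun i a => Polynomial.C a * (oreOperator σ δ ^ i) g := by
    conv_lhs => rw [oreEval, Polynomial.lsum_apply, Polynomial.sum, map_sum, LinearMap.sum_apply]
    refine Finset.sum_congr rfl fun i _ => ?_
    simp [hact, hactx]
  -- The coefficient in degree `deg f + deg g` is the leading coefficient of `f` times the image
  -- under `σ ^ deg f` of that of `g`; it is nonzero as `σ` is injective and `A` has no zero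
  -- divisors.
  have hlead {f g : Polynomial A} (hf : f ≠ 0) (hg : g ≠ 0) : act (oreEval inc x f) g ≠ 0 := by
    intro h
    have h1 := congrArg (fun p => Polynomial.coeff p (g.natDegree + f.natDegree)) h
    simp only [hact', Polynomial.sum, Polynomial.finsetSum_coeff, Polynomial.coeff_C_mul,
      Polynomial.coeff_zero] at h1
    rw [Finset.sum_eq_single f.natDegree] at h1
    · rw [(coeff_oreOperator_pow σ δ g f.natDegree).2] at h1
      refine mul_ne_zero (Polynomial.leadingCoeff_ne_zero.2 hf) ?_ h1
      have hσi : Function.Injective (σ ^ f.natDegree : A →ₐ[K] A) := by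
        rw [AlgHom.coe_pow]
        exact hσ.iterate _
      exact (map_ne_zero_iff _ hσi).2 (Polynomial.leadingCoeff_ne_zero.2 hg)
    · intro i hi hne
      have := Polynomial.le_natDegree_of_mem_supp i hi
      rw [(coeff_oreOperator_pow σ δ g i).1 _ (by omega), mul_zero]
    · intro h'
      rw [Polynomial.notMem_support_iff.1 h', zero_mul]
  refine ⟨fun {a b} hab => ?_⟩
  by_contra! hne
  have h (g : A') (hg : g ≠ 0) : act g 1 ≠ 0 := fun h => hg (by rw [hinv g, h, map_zero])
  refine hlead (h a hne.1) (h b hne.2) ?_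
  rw [← hinv, ← Module.End.mul_apply, ← map_mul, hab, map_zero, LinearMap.zero_apply]

end Ore

/-! ### The overlap computation for three generators -/

section Overlap

/-- The commutation coefficient of two generators of the algebra of quantum matrices. -/
def commCoeff {K : Type*} [Field K] (q : K) {m n : ℕ} (i : Fin m) (j : Fin n) (h : Fin m) (l : Fin n) :
    K :=
  if i = h ∨ j = l then q⁻¹ else 1

/-- The coefficient of the correction term in the commutation relation of two generators of the algebra
of quantum matrices. -/
def corrCoeff {K : Type*} [Field K] (q : K) {m n : ℕ} (i : Fin m) (j : Fin n) (h : Fin m) (l : Fin n) :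
    K :=
  if i < h ∧ j < l then q - q⁻¹ else 0

variable {K : Type*} [Field K] {q : K} {A : Type*} [Ring A] [Algebra K A] {m n : ℕ}

theorem commCoeff_row (q : K) (i : Fin m) (j l : Fin n) : commCoeff q i j i l = q⁻¹ := by
  simp [commCoeff]

theorem commCoeff_col (q : K) (i h : Fin m) (j : Fin n) : commCoeff q i j h j = q⁻¹ := by
  simp [commCoeff]

theorem commCoeff_of_ne (q : K) {i h : Fin m} {j l : Fin n} (hi : i ≠ h) (hj : j ≠ l) :
    commCoeff q i j h l = 1 := by
  simp [commCoeff, hi, hj]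

theorem corrCoeff_of_lt (q : K) {i h : Fin m} {j l : Fin n} (hi : i < h) (hj : j < l) :
    corrCoeff q i j h l = q - q⁻¹ := by
  simp [corrCoeff, hi, hj]

theorem corrCoeff_of_row_not_lt (q : K) {i h : Fin m} (j l : Fin n) (hi : ¬ i < h) :
    corrCoeff q i j h l = 0 := by
  simp [corrCoeff, hi]

theorem corrCoeff_of_col_not_lt (q : K) (i h : Fin m) {j l : Fin n} (hj : ¬ j < l) :
    corrCoeff q i j h l = 0 := by
  simp [corrCoeff, hj]

set_option linter.unusedSimpArgs false in
set_option maxHeartbeats 2000000 in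
/-- The compatibility of the derivation attached to the generator in position `(r, s)` with the
commutation relation of two smaller generators. -/
theorem overlap_identity (hq0 : q ≠ 0) (x : Fin m → Fin n → A) (r : Fin m) (s : Fin n)
    (P : Fin m → Fin n → Prop) (hP : ∀ i j, i < r → P i j) (hP' : ∀ j, j < s → P r j)
    (hrow : ∀ i j l, j < l → P i l → x i l * x i j = q⁻¹ • (x i j * x i l))
    (hcol : ∀ i h j, i < h → P h j → x h j * x i j = q⁻¹ • (x i j * x h j))
    (hanti : ∀ i h j l, i < h → l < j → P h l → x h l * x i j = x i j * x h l)
    (hdiag : ∀ i h j l, i < h → j < l → P h l →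
      x h l * x i j = x i j * x h l - (q - q⁻¹) • (x i l * x h j))
    (i h : Fin m) (j l : Fin n) (hp : i < h ∨ i = h ∧ j < l) (hp' : h < r ∨ h = r ∧ l < s) :
    commCoeff q h l r s • (x h l * (corrCoeff q i j r s • (x i s * x r j))) +
        (corrCoeff q h l r s • (x h s * x r l)) * x i j =
      commCoeff q i j h l • (commCoeff q i j r s • (x i j * (corrCoeff q h l r s • (x h s * x r l))) +
        (corrCoeff q i j r s • (x i s * x r j)) * x h l) -
      corrCoeff q i j h l • (commCoeff q i l r s • (x i l * (corrCoeff q h j r s • (x h s * x r j))) +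
        (corrCoeff q i l r s • (x i s * x r l)) * x h j) := by
  have hrow' : ∀ i j l, j < l → P i l → ∀ z,
      x i l * (x i j * z) = q⁻¹ • (x i j * (x i l * z)) := fun i j l h1 h2 z => by
    rw [← mul_assoc, hrow i j l h1 h2, smul_mul_assoc, mul_assoc]
  have hcol' : ∀ i h j, i < h → P h j → ∀ z,
      x h j * (x i j * z) = q⁻¹ • (x i j * (x h j * z)) := fun i j l h1 h2 z => by
    rw [← mul_assoc, hcol i j l h1 h2, smul_mul_assoc, mul_assoc]
  replace hanti : ∀ i h j l, i < h → l < j → P h l →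
      x h l * x i j = (1 : K) • (x i j * x h l) := fun i h j l h1 h2 h3 => by
    rw [hanti i h j l h1 h2 h3, one_smul]
  have hanti' : ∀ i h j l, i < h → l < j → P h l → ∀ z,
      x h l * (x i j * z) = (1 : K) • (x i j * (x h l * z)) := fun i h j l h1 h2 h3 z => by
    rw [← mul_assoc, hanti i h j l h1 h2 h3, smul_mul_assoc, mul_assoc]
  have hdiag' : ∀ i h j l, i < h → j < l → P h l → ∀ z,
      x h l * (x i j * z) = x i j * (x h l * z) - (q - q⁻¹) • (x i l * (x h j * z)) :=
    fun i h j l h1 h2 h3 z => by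
    rw [← mul_assoc, hdiag i h j l h1 h2 h3, sub_mul, mul_assoc, smul_mul_assoc, mul_assoc]
  have hir : i < r ∨ i = r := by rcases hp with hp | ⟨hp, -⟩ <;> rcases hp' with hp' | ⟨hp', -⟩ <;> order
  have t1 := lt_trichotomy j l
  have t2 := lt_trichotomy l s
  have t3 := lt_trichotomy j s
  -- The coefficients depend only on the relative order of the rows `i, h, r` and of the columns `j,
  -- l, s`. In each consistent case the words are rewritten into a normal order and their scalars
  -- compared.
  rcases hp with hi | ⟨rfl, hj⟩ <;> rcases hp' with hh | ⟨rfl, hl⟩ <;> rcases hir with hir | hir <;>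
    rcases t1 with t1 | rfl | t1 <;> rcases t2 with t2 | rfl | t2 <;> rcases t3 with t3 | t3 | t3 <;>
    first
    | (exfalso; order)
    | skip
  all_goals try subst t3
  all_goals simp (disch := first | order | fail) only [commCoeff_row, commCoeff_col, commCoeff_of_ne,
    corrCoeff_of_lt, corrCoeff_of_row_not_lt, corrCoeff_of_col_not_lt, zero_smul, mul_zero, zero_mul,
    smul_zero, add_zero, zero_add, sub_zero, one_smul]
  all_goals try simp (disch := first | assumption | (apply hP; assumption) | (apply hP'; assumption) | fail)
    only [mul_assoc, smul_mul_assoc, mul_smul_comm, mul_sub, sub_mul, smul_sub,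
      hrow, hrow', hcol, hcol', hanti, hanti', hdiag, hdiag']
  all_goals try (match_scalars <;> field_simp <;> ring1)
end Overlap

/-! ### Adjoining the generators one at a time -/

/-- A family with entries in a `K`-algebra, vanishing outside of `S`, that satisfies the relations of
quantum matrices between the entries with positions in `S`. -/
structure IsPartialQuantum {K : Type*} [Field K] (q : K) {A : Type*} [Ring A] [Algebra K A] {m n : ℕ}
    (S : Set (Fin m × Fin n)) (x : Fin m → Fin n → A) : Prop where
  zero : ∀ i j, (i, j) ∉ S → x i j = 0
  comm : ∀ i j h l, (i < h ∨ i = h ∧ j < l) → (i, j) ∈ S → (h, l) ∈ S →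
    x h l * x i j = commCoeff q i j h l • (x i j * x h l) - corrCoeff q i j h l • (x i l * x h j)

/-- The defining relations of the algebra generated by the quantum matrix entries in `S`. -/
inductive PartialQuantumMatrixRel {K : Type*} [Field K] (q : K) {m n : ℕ} (S : Set (Fin m × Fin n)) :
    FreeAlgebra K (Fin m × Fin n) → FreeAlgebra K (Fin m × Fin n) → Prop
  | zero (p : Fin m × Fin n) (hp : p ∉ S) : PartialQuantumMatrixRel q S (FreeAlgebra.ι K p) 0
  | comm (i : Fin m) (j : Fin n) (h : Fin m) (l : Fin n) (hlt : i < h ∨ i = h ∧ j < l)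
      (hp : (i, j) ∈ S) (hp' : (h, l) ∈ S) : PartialQuantumMatrixRel q S
        (FreeAlgebra.ι K (h, l) * FreeAlgebra.ι K (i, j))
        (commCoeff q i j h l • (FreeAlgebra.ι K (i, j) * FreeAlgebra.ι K (h, l)) -
          corrCoeff q i j h l • (FreeAlgebra.ι K (i, l) * FreeAlgebra.ι K (h, j)))

/-- The algebra generated by the quantum matrix entries in `S`. -/
abbrev PartialQuantumMatrix {K : Type*} [Field K] (q : K) {m n : ℕ} (S : Set (Fin m × Fin n)) : Type _ :=
  RingQuot (PartialQuantumMatrixRel q S)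

theorem ringQuot_adjoin_range {K : Type*} [Field K] {X : Type*}
    (rel : FreeAlgebra K X → FreeAlgebra K X → Prop) :
    Algebra.adjoin K (Set.range fun p => RingQuot.mkAlgHom K rel (FreeAlgebra.ι K p)) = ⊤ := by
  have h : (Set.range fun p => RingQuot.mkAlgHom K rel (FreeAlgebra.ι K p)) =
      RingQuot.mkAlgHom K rel '' Set.range (FreeAlgebra.ι K) := by
    rw [← Set.range_comp]
    rfl
  rw [h, ← AlgHom.map_adjoin, FreeAlgebra.adjoin_range_ι, Algebra.map_top, AlgHom.range_eq_top]
  exact RingQuot.mkAlgHom_surjective K rel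

namespace PartialQuantumMatrix

variable {K : Type*} [Field K] {q : K} {A : Type*} [Ring A] [Algebra K A] {m n : ℕ}
  {S : Set (Fin m × Fin n)}

/-- The canonical generators. -/
noncomputable def gen (q : K) (S : Set (Fin m × Fin n)) (i : Fin m) (j : Fin n) :
    PartialQuantumMatrix q S :=
  RingQuot.mkAlgHom K (PartialQuantumMatrixRel q S) (FreeAlgebra.ι K (i, j))

theorem gen_isPartialQuantum (q : K) (S : Set (Fin m × Fin n)) : IsPartialQuantum q S (gen q S) where
  zero i j h := by
    rw [gen, RingQuot.mkAlgHom_rel K (PartialQuantumMatrixRel.zero (i, j) h), map_zero]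
  comm i j h l hlt hp hp' := by
    have := RingQuot.mkAlgHom_rel K (PartialQuantumMatrixRel.comm (q := q) i j h l hlt hp hp')
    simp only [map_mul, map_sub, map_smul] at this
    exact this

/-- The universal property. -/
noncomputable def lift {x : Fin m → Fin n → A} (hx : IsPartialQuantum q S x) :
    PartialQuantumMatrix q S →ₐ[K] A :=
  RingQuot.liftAlgHom K ⟨FreeAlgebra.lift K fun p => x p.1 p.2, fun a b h => by
    induction h with
    | zero p hp => rw [FreeAlgebra.lift_ι_apply, map_zero, hx.zero _ _ hp]
    | comm i j h l hlt hp hp' =>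
      simpa only [map_mul, map_sub, map_smul, FreeAlgebra.lift_ι_apply] using
        hx.comm i j h l hlt hp hp'⟩

theorem lift_gen {x : Fin m → Fin n → A} (hx : IsPartialQuantum q S x) (i : Fin m) (j : Fin n) :
    lift hx (gen q S i j) = x i j := by
  rw [lift, gen, RingQuot.liftAlgHom_mkAlgHom_apply, FreeAlgebra.lift_ι_apply]

theorem induction {p : PartialQuantumMatrix q S → Prop} (hgen : ∀ i j, p (gen q S i j))
    (halg : ∀ r, p (algebraMap K _ r)) (hadd : ∀ a b, p a → p b → p (a + b))
    (hmul : ∀ a b, p a → p b → p (a * b)) (a : PartialQuantumMatrix q S) : p a := by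
  have ha : a ∈ Algebra.adjoin K (Set.range fun p =>
      RingQuot.mkAlgHom K (PartialQuantumMatrixRel q S) (FreeAlgebra.ι K p)) := by
    rw [ringQuot_adjoin_range]
    trivial
  induction ha using Algebra.adjoin_induction with
  | mem a ha => obtain ⟨⟨i, j⟩, rfl⟩ := ha; exact hgen i j
  | algebraMap r => exact halg r
  | add a b _ _ ha hb => exact hadd a b ha hb
  | mul a b _ _ ha hb => exact hmul a b ha hb

end PartialQuantumMatrix

/-- The condition on `c` says that both products in a correction term are scaled alike; the other
terms of a relation always are. It supplies the automorphism `σ` of each Ore extension. -/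
theorem IsPartialQuantum.scale {K : Type*} [Field K] {q : K} {A : Type*} [Ring A] [Algebra K A] {m n : ℕ}
    {S : Set (Fin m × Fin n)} {x : Fin m → Fin n → A} (hx : IsPartialQuantum q S x)
    (c : Fin m → Fin n → K)
    (hc : ∀ i j h l, i < h → j < l → (i, j) ∈ S → (h, l) ∈ S → c i j * c h l = c i l * c h j) :
    IsPartialQuantum q S fun i j => c i j • x i j where
  zero i j h := by rw [hx.zero i j h, smul_zero]
  comm i j h l hlt hp hp' := by
    rw [smul_mul_smul_comm, hx.comm i j h l hlt hp hp', smul_mul_smul_comm, smul_mul_smul_comm, smul_sub]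
    by_cases hlt' : i < h ∧ j < l
    · rw [← hc i j h l hlt'.1 hlt'.2 hp hp', mul_comm (c h l)]
      module
    · rw [corrCoeff, if_neg hlt', mul_comm (c h l)]
      module

section Stage

variable {K : Type*} [Field K] {q : K} {m n : ℕ}

/-- The positions preceding `(r, s)` in the lexicographic order. -/
def lexBelow (r : Fin m) (s : Fin n) : Set (Fin m × Fin n) := {p | p.1 < r ∨ p.1 = r ∧ p.2 < s}

theorem commCoeff_mul_commCoeff (q : K) (r : Fin m) (s : Fin n) (i : Fin m) (j : Fin n) (h : Fin m)
    (l : Fin n) (hi : i < h) (hj : j < l) (hp' : (h, l) ∈ lexBelow r s) :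
    commCoeff q i j r s * commCoeff q h l r s = commCoeff q i l r s * commCoeff q h j r s := by
  rcases hp' with hh | ⟨hh, hl⟩
  · simp [commCoeff, hh.ne, (hi.trans hh).ne, mul_comm]
  · have hl' : l ≠ s := ne_of_lt hl
    have hh' : h = r := hh
    subst hh'
    simp [commCoeff, hi.ne, hl', (hj.trans hl).ne]

/-- A `σ`-derivation `δ` amounts to an algebra map `a ↦ (σ a, δ a; 0, a)` into triangular matrices,
so its existence reduces to checking relations on these matrices. The diagonal entries are
immediate; the upper right entry is `overlap_identity`. -/
theorem IsPartialQuantum.overlap {A : Type*} [Ring A] [Algebra K A] (hq0 : q ≠ 0) {r : Fin m} {s : Fin n}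
    {x : Fin m → Fin n → A} (hx : IsPartialQuantum q (lexBelow r s) x) :
    IsPartialQuantum q (lexBelow r s) fun i j =>
      !![commCoeff q i j r s • x i j, -(corrCoeff q i j r s • (x i s * x r j)); 0, x i j] where
  zero i j h := by
    have hi : ¬ (i < r ∧ j < s) := fun h' => h (Or.inl h'.1)
    rw [hx.zero i j h, corrCoeff, if_neg hi]
    ext a b
    fin_cases a <;> fin_cases b <;> simp
  comm i j h l hlt hp hp' := by
    have hlow {i h : Fin m} {j l : Fin n} (h1 : i < h ∨ i = h ∧ j < l) (h2 : (h, l) ∈ lexBelow r s) :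
        (i, j) ∈ lexBelow r s := by
      rcases h1 with h1 | ⟨rfl, h1⟩ <;> rcases h2 with h2 | ⟨h2, h3⟩
      · exact Or.inl (h1.trans h2)
      · exact Or.inl (h1.trans_eq h2)
      · exact Or.inl h2
      · exact Or.inr ⟨h2, h1.trans h3⟩
    have e := overlap_identity hq0 x r s (fun i j => (i, j) ∈ lexBelow r s) (fun i j h => Or.inl h)
      (fun j h => Or.inr ⟨rfl, h⟩)
      (fun i j l hj hp => by
        rw [hx.comm i j i l (Or.inr ⟨rfl, hj⟩) (hlow (Or.inr ⟨rfl, hj⟩) hp) hp, commCoeff_row,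
          corrCoeff_of_row_not_lt q j l (lt_irrefl i), zero_smul, sub_zero])
      (fun i h j hi hp => by
        rw [hx.comm i j h j (Or.inl hi) (hlow (Or.inl hi) hp) hp, commCoeff_col,
          corrCoeff_of_col_not_lt q i h (lt_irrefl j), zero_smul, sub_zero])
      (fun i h j l hi hj hp => by
        rw [hx.comm i j h l (Or.inl hi) (hlow (Or.inl hi) hp) hp, commCoeff_of_ne q hi.ne hj.ne',
          corrCoeff_of_col_not_lt q i h hj.not_gt, zero_smul, sub_zero, one_smul])
      (fun i h j l hi hj hp => by
        rw [hx.comm i j h l (Or.inl hi) (hlow (Or.inl hi) hp) hp, commCoeff_of_ne q hi.ne hj.ne,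
          corrCoeff_of_lt q hi hj, one_smul])
      i h j l hlt hp'
    have hs := (hx.scale (fun i j => commCoeff q i j r s) fun i j h l hi hj _ hp' =>
      commCoeff_mul_commCoeff q r s i j h l hi hj hp').comm i j h l hlt hp hp'
    ext a b
    fin_cases a <;> fin_cases b
    · simpa [Matrix.mul_apply, smul_smul, mul_comm, mul_left_comm] using hs
    · simp only [Fin.zero_eta, Fin.mk_one, Matrix.sub_apply, Matrix.smul_apply, Matrix.mul_apply,
        Fin.sum_univ_two, Matrix.of_apply, Matrix.cons_val', Matrix.cons_val_zero, Matrix.cons_val_one,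
        Matrix.cons_val_fin_one, mul_neg, neg_mul, smul_mul_assoc] at e ⊢
      rw [← sub_eq_zero] at e ⊢
      rw [← neg_eq_zero, ← e]
      module
    · simp [Matrix.mul_apply]
    · simpa [Matrix.mul_apply] using hx.comm i j h l hlt hp hp'

theorem commCoeff_ne_zero (hq0 : q ≠ 0) (i : Fin m) (j : Fin n) (h : Fin m) (l : Fin n) :
    commCoeff q i j h l ≠ 0 := by
  rw [commCoeff]
  split_ifs
  · exact inv_ne_zero hq0
  · exact one_ne_zero

/-- Lexicographic initial segments are closed under the relations: a nonzero correction term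
introduces no later generator. -/
theorem mem_lexBelow_of_corrCoeff {i h r : Fin m} {j l s : Fin n} (hp : (h, l) ∈ lexBelow r s)
    (hne : i < h ∧ j < l) : (i, l) ∈ lexBelow r s ∧ (h, j) ∈ lexBelow r s := by
  rcases hp with hp | ⟨hp, hp'⟩
  · exact ⟨Or.inl (hne.1.trans hp), Or.inl hp⟩
  · exact ⟨Or.inl (hne.1.trans_eq hp), Or.inr ⟨hp, hne.2.trans hp'⟩⟩

theorem notMem_lexBelow (r : Fin m) (s : Fin n) : (r, s) ∉ lexBelow r s := by simp [lexBelow]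

/-- Left multiplication by constants, on polynomials. -/
noncomputable def polyMulLeft (K : Type*) [Field K] (A : Type*) [Ring A] [Algebra K A] :
    A →ₐ[K] Module.End K (Polynomial A) :=
  (Algebra.lmul K _).comp Polynomial.CAlgHom

-- The new generator acts on polynomials by the Ore operator and the old ones by constants.
-- Relations with the new generator are the twisted Leibniz rule; those among old generators are
-- inherited.
open Classical in
theorem IsPartialQuantum.oreOperator {A : Type*} [Ring A] [Algebra K A] {r : Fin m} {s : Fin n}
    {g : Fin m → Fin n → A} (hg : IsPartialQuantum q (lexBelow r s) g) {σ : A →ₐ[K] A} {δ : A →ₗ[K] A}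
    (hδ : ∀ a b, δ (a * b) = σ a * δ b + δ a * b)
    (hσg : ∀ i j, σ (g i j) = commCoeff q i j r s • g i j)
    (hδg : ∀ i j, δ (g i j) = -(corrCoeff q i j r s • (g i s * g r j))) :
    IsPartialQuantum q (insert (r, s) (lexBelow r s)) fun i j =>
      if (i, j) = (r, s) then _root_.oreOperator σ δ else polyMulLeft K A (g i j) where
  zero i j h := by
    rw [if_neg fun h' => h (Or.inl h'), hg.zero i j fun h' => h (Or.inr h'), map_zero]
  comm i j h l hlt hp hp' := by
    have hp0 : (i, j) ≠ (r, s) := by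
      rintro h'
      rw [Prod.mk.injEq] at h'
      obtain ⟨rfl, rfl⟩ := h'
      rcases hp' with hp' | hp' | ⟨hp', hp''⟩
      · rw [Prod.mk.injEq] at hp'
        rcases hlt with hlt | ⟨-, hlt⟩
        · exact hlt.ne' hp'.1
        · exact hlt.ne' hp'.2
      · rcases hlt with hlt | ⟨hlt, -⟩
        · exact lt_asymm hlt hp'
        · exact hlt.not_gt hp'
      · rcases hlt with hlt | ⟨-, hlt⟩
        · exact hlt.ne' hp'
        · exact lt_asymm hlt hp''
    have hpS : (i, j) ∈ lexBelow r s := hp.resolve_left hp0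
    rw [if_neg hp0]
    rcases eq_or_ne (h, l) (r, s) with heq | hne
    · rw [if_pos heq]
      rw [Prod.mk.injEq] at heq
      obtain ⟨rfl, rfl⟩ := heq
      have h1 : _root_.oreOperator σ δ * polyMulLeft K A (g i j) =
          polyMulLeft K A (σ (g i j)) * _root_.oreOperator σ δ + polyMulLeft K A (δ (g i j)) :=
        LinearMap.ext fun f => oreOperator_C_mul hδ (g i j) f
      rw [h1, hσg, hδg, map_smul, map_neg, map_smul, map_mul, smul_mul_assoc, ← sub_eq_add_neg]
      congr 1
      by_cases hne : i < h ∧ j < l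
      · rw [if_neg fun h' => hne.1.ne (Prod.mk.inj h').1, if_neg fun h' => hne.2.ne (Prod.mk.inj h').2]
      · rw [corrCoeff, if_neg hne, zero_smul, zero_smul]
    · have hpS' : (h, l) ∈ lexBelow r s := hp'.resolve_left hne
      rw [if_neg hne, ← map_mul, hg.comm i j h l hlt hpS hpS', map_sub, map_smul, map_smul, map_mul,
        map_mul]
      congr 1
      by_cases hne : i < h ∧ j < l
      · have := mem_lexBelow_of_corrCoeff hpS' hne
        rw [if_neg fun h' : (i, l) = (r, s) => notMem_lexBelow r s (h' ▸ this.1),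
          if_neg fun h' : (h, j) = (r, s) => notMem_lexBelow r s (h' ▸ this.2)]
      · rw [corrCoeff, if_neg hne, zero_smul, zero_smul]

/-- Adjoining one quantum matrix entry to a domain gives a domain. -/
theorem noZeroDivisors_insert (hq0 : q ≠ 0) (r : Fin m) (s : Fin n)
    [NoZeroDivisors (PartialQuantumMatrix q (lexBelow r s))] :
    NoZeroDivisors (PartialQuantumMatrix q (insert (r, s) (lexBelow r s))) := by
  classical
  set S := lexBelow r s with hS
  set S' := insert (r, s) S with hS'
  have hg := PartialQuantumMatrix.gen_isPartialQuantum q S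
  have hg' := PartialQuantumMatrix.gen_isPartialQuantum q S'
  set g := PartialQuantumMatrix.gen q S
  set g' := PartialQuantumMatrix.gen q S'
  have hrs : (r, s) ∉ S := notMem_lexBelow r s
  have hcc (i : Fin m) (j : Fin n) (h : Fin m) (l : Fin n) (hi : i < h) (hj : j < l)
      (hp' : (h, l) ∈ S) := commCoeff_mul_commCoeff q r s i j h l hi hj hp'
  let σ := PartialQuantumMatrix.lift (hg.scale (fun i j => commCoeff q i j r s)
    fun i j h l hi hj _ hp' => hcc i j h l hi hj hp')
  let σ' := PartialQuantumMatrix.lift (hg.scale (fun i j => (commCoeff q i j r s)⁻¹)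
    fun i j h l hi hj _ hp' => by rw [← mul_inv, hcc i j h l hi hj hp', mul_inv])
  have hσg (i : Fin m) (j : Fin n) : σ (g i j) = commCoeff q i j r s • g i j :=
    PartialQuantumMatrix.lift_gen _ i j
  have hσ : Function.Injective σ := by
    refine Function.LeftInverse.injective (g := σ') fun a => ?_
    induction a using PartialQuantumMatrix.induction with
    | hgen i j =>
      rw [show PartialQuantumMatrix.gen q S = g from rfl, hσg, map_smul,
        show σ' (g i j) = (commCoeff q i j r s)⁻¹ • g i j from PartialQuantumMatrix.lift_gen _ i j,
        smul_smul, mul_inv_cancel₀ (commCoeff_ne_zero hq0 i j r s), one_smul]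
    | halg c => simp
    | hadd a b ha hb => rw [map_add, map_add, ha, hb]
    | hmul a b ha hb => rw [map_mul, map_mul, ha, hb]
  -- The derivation `δ` is read off as the upper right entry of this triangular representation.
  let Ψ : PartialQuantumMatrix q S →ₐ[K] _ := PartialQuantumMatrix.lift (hg.overlap hq0)
  have hΨg (i : Fin m) (j : Fin n) : Ψ (g i j) = _ := PartialQuantumMatrix.lift_gen _ i j
  have hΨ (a : PartialQuantumMatrix q S) : Ψ a 0 0 = σ a ∧ Ψ a 1 0 = 0 ∧ Ψ a 1 1 = a := by
    induction a using PartialQuantumMatrix.induction with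
    | hgen i j =>
      rw [show PartialQuantumMatrix.gen q S = g from rfl, hΨg, hσg]
      simp
    | halg c => simp [Matrix.algebraMap_matrix_apply]
    | hadd a b ha hb => simp [ha, hb]
    | hmul a b ha hb => simp [ha, hb, Matrix.mul_apply]
  let δ : PartialQuantumMatrix q S →ₗ[K] PartialQuantumMatrix q S :=
    { toFun := fun a => Ψ a 0 1
      map_add' := fun a b => by simp
      map_smul' := fun c a => by simp }
  have hδ (a b : PartialQuantumMatrix q S) : δ (a * b) = σ a * δ b + δ a * b := by
    change Ψ (a * b) 0 1 = σ a * Ψ b 0 1 + Ψ a 0 1 * b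
    rw [map_mul, Matrix.mul_apply, Fin.sum_univ_two, (hΨ a).1, (hΨ b).2.2]
  have hδg (i : Fin m) (j : Fin n) : δ (g i j) = -(corrCoeff q i j r s • (g i s * g r j)) := by
    change Ψ (g i j) 0 1 = _
    rw [hΨg]
    simp
  have hδ1 (c : K) : δ (algebraMap K _ c) = 0 := by
    change Ψ (algebraMap K _ c) 0 1 = 0
    simp [Matrix.algebraMap_matrix_apply]
  -- The source kills all generators outside `S`, including `(r, s)`, which survives as a generator
  -- of the target; hence the cut-off.
  have hinc : IsPartialQuantum q S fun i j => if (i, j) ∈ S then g' i j else 0 :=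
    { zero := fun i j h => if_neg h
      comm := fun i j h l hlt hp hp' => by
        have := hg'.comm i j h l hlt (Or.inr hp) (Or.inr hp')
        simp only [hp, hp', if_true]
        rw [this]
        congr 1
        by_cases hne : i < h ∧ j < l
        · have := mem_lexBelow_of_corrCoeff hp' hne
          rw [if_pos this.1, if_pos this.2]
        · rw [corrCoeff, if_neg hne, zero_smul, zero_smul] }
  let inc := PartialQuantumMatrix.lift hinc
  have hincg (i : Fin m) (j : Fin n) : inc (g i j) = if (i, j) ∈ S then g' i j else 0 :=
    PartialQuantumMatrix.lift_gen _ i j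
  have hx (a : PartialQuantumMatrix q S) : g' r s * inc a = inc (σ a) * g' r s + inc (δ a) := by
    induction a using PartialQuantumMatrix.induction with
    | hgen i j =>
      rw [show PartialQuantumMatrix.gen q S = g from rfl, hσg, hδg, map_smul, hincg, map_neg, map_smul,
        map_mul, hincg, hincg]
      by_cases hp : (i, j) ∈ S
      · rw [if_pos hp, hg'.comm i j r s hp (Or.inr hp) (Or.inl rfl), sub_eq_add_neg, smul_mul_assoc]
        congr 2
        by_cases hne : i < r ∧ j < s
        · have h1 : (i, s) ∈ S := Or.inl hne.1
          have h2 : (r, j) ∈ S := Or.inr ⟨rfl, hne.2⟩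
          rw [if_pos h1, if_pos h2]
        · rw [corrCoeff, if_neg hne, zero_smul, zero_smul]
      · have hne : ¬ (i < r ∧ j < s) := fun h => hp (Or.inl h.1)
        simp [hp, corrCoeff, hne]
    | halg c => simp [hδ1, Algebra.commutes]
    | hadd a b ha hb => simp only [map_add, mul_add, add_mul, ha, hb]; abel
    | hmul a b ha hb =>
      rw [map_mul, ← mul_assoc, ha, add_mul, mul_assoc, hb, hδ]
      simp only [map_mul, map_add, mul_add, mul_assoc, add_assoc]
  have hact := hg.oreOperator hδ hσg hδg
  let act : PartialQuantumMatrix q S' →ₐ[K] _ := PartialQuantumMatrix.lift hact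
  have hactg (i : Fin m) (j : Fin n) : act (g' i j) = if (i, j) = (r, s) then oreOperator σ δ else
      polyMulLeft K _ (g i j) := PartialQuantumMatrix.lift_gen _ i j
  refine noZeroDivisors_of_ore hσ inc (g' r s) hx ?_ act (fun a f => ?_) (by rw [hactg, if_pos rfl])
  · rw [eq_top_iff, ← ringQuot_adjoin_range, Algebra.adjoin_le_iff]
    rintro _ ⟨⟨i, j⟩, rfl⟩
    change g' i j ∈ _
    by_cases hp : (i, j) ∈ S'
    · rcases hp with hp | hp
      · rw [Prod.mk.injEq] at hp
        obtain ⟨rfl, rfl⟩ := hp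
        exact Algebra.subset_adjoin (Or.inr rfl)
      · exact Algebra.subset_adjoin (Or.inl ⟨g i j, by rw [hincg, if_pos hp]⟩)
    · rw [hg'.zero i j hp]
      exact zero_mem _
  · suffices h : act (inc a) = polyMulLeft K _ a by rw [h]; rfl
    clear f
    induction a using PartialQuantumMatrix.induction with
    | hgen i j =>
      rw [show PartialQuantumMatrix.gen q S = g from rfl, hincg]
      by_cases hp : (i, j) ∈ S
      · rw [if_pos hp, hactg, if_neg fun h' : (i, j) = (r, s) => hrs (h' ▸ hp)]
      · rw [if_neg hp, hg.zero i j hp, map_zero, map_zero]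
    | halg c => simp
    | hadd a b ha hb => rw [map_add, map_add, ha, hb, map_add]
    | hmul a b ha hb => rw [map_mul, map_mul, ha, hb, map_mul]

/-- With every generator killed the algebra is a quotient of `K`, the base of the tower. -/
theorem noZeroDivisors_empty (q : K) (m n : ℕ) :
    NoZeroDivisors (PartialQuantumMatrix q (∅ : Set (Fin m × Fin n))) := by
  have hs : Function.Surjective
      (algebraMap K (PartialQuantumMatrix q (∅ : Set (Fin m × Fin n)))) := by
    intro a
    induction a using PartialQuantumMatrix.induction with
    | hgen i j =>
      exact ⟨0, by rw [map_zero, (PartialQuantumMatrix.gen_isPartialQuantum q _).zero i j (by simp)]⟩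
    | halg c => exact ⟨c, rfl⟩
    | hadd a b ha hb =>
      obtain ⟨u, rfl⟩ := ha
      obtain ⟨v, rfl⟩ := hb
      exact ⟨u + v, map_add _ _ _⟩
    | hmul a b ha hb =>
      obtain ⟨u, rfl⟩ := ha
      obtain ⟨v, rfl⟩ := hb
      exact ⟨u * v, map_mul _ _ _⟩
  refine ⟨fun {a b} hab => ?_⟩
  obtain ⟨u, rfl⟩ := hs a
  by_cases hu : u = 0
  · exact Or.inl (by rw [hu, map_zero])
  · right
    have := congrArg (fun z => algebraMap K _ u⁻¹ * z) hab
    simpa [← mul_assoc, ← map_mul, inv_mul_cancel₀ hu] using this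

theorem noZeroDivisors_partial (hq0 : q ≠ 0) (m n N : ℕ) (hN : N ≤ m * n) :
    NoZeroDivisors (PartialQuantumMatrix q {p : Fin m × Fin n | (finProdFinEquiv p).val < N}) := by
  induction N with
  | zero =>
    have h0 : {p : Fin m × Fin n | (finProdFinEquiv p).val < 0} = ∅ := by
      ext p
      simp
    rw [h0]
    exact noZeroDivisors_empty q m n
  | succ N ih =>
    obtain ⟨⟨r, s⟩, hrs⟩ := finProdFinEquiv.surjective (⟨N, hN⟩ : Fin (m * n))
    have hval : s.val + n * r.val = N := congrArg Fin.val hrs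
    -- `finProdFinEquiv` numbers the positions row by row, that is, lexicographically.
    have h1 : {p : Fin m × Fin n | (finProdFinEquiv p).val < N} = lexBelow r s := by
      ext ⟨i, j⟩
      simp only [lexBelow, Set.mem_ofPred_eq, finProdFinEquiv_apply_val, ← hval, Fin.lt_def, Fin.ext_iff]
      have hj := j.isLt
      have hs := s.isLt
      constructor
      · intro h
        rcases lt_trichotomy i.val r.val with h' | h' | h'
        · exact Or.inl h'
        · rw [h'] at h
          exact Or.inr ⟨h', by omega⟩
        · have : n * (r.val + 1) ≤ n * i.val := Nat.mul_le_mul_left _ h'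
          rw [mul_add] at this
          omega
      · rintro (h | ⟨h, h'⟩)
        · have : n * (i.val + 1) ≤ n * r.val := Nat.mul_le_mul_left _ h
          rw [mul_add] at this
          omega
        · rw [h]
          omega
    have h2 : {p : Fin m × Fin n | (finProdFinEquiv p).val < N + 1} = insert (r, s) (lexBelow r s) := by
      rw [← h1]
      ext p
      simp only [Set.mem_ofPred_eq, Set.mem_insert_iff, Nat.lt_succ_iff_lt_or_eq]
      rw [or_comm, ← finProdFinEquiv.injective.eq_iff, hrs, Fin.ext_iff]
    have := ih (by omega)
    rw [h1] at this
    rw [h2]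
    exact noZeroDivisors_insert hq0 r s

end Stage

/-! ### The algebra of quantum matrices: universal property and absence of zero divisors -/

namespace QuantumMatrix

variable {K : Type*} [Field K] {q : K} {A : Type*} [Ring A] [Algebra K A] {m n : ℕ}

theorem gen_isQuantum (q : K) (m n : ℕ) : IsQuantum q (gen q m n) where
  row i j l h := by
    have := RingQuot.mkAlgHom_rel K (QuantumMatrixRel.row (q := q) (m := m) i j l h)
    simp only [map_mul, map_smul] at this
    exact this
  col i k j h := by
    have := RingQuot.mkAlgHom_rel K (QuantumMatrixRel.col (q := q) (n := n) i k j h)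
    simp only [map_mul, map_smul] at this
    exact this
  anti i k j l h h' := by
    have := RingQuot.mkAlgHom_rel K (QuantumMatrixRel.anti (q := q) i k j l h h')
    simp only [map_mul] at this
    exact this
  diag i k j l h h' := by
    have := RingQuot.mkAlgHom_rel K (QuantumMatrixRel.diag (q := q) i k j l h h')
    simp only [map_mul, map_smul, map_sub] at this
    exact this

/-- The universal property of the algebra of quantum matrices. -/
noncomputable def lift {x : Matrix (Fin m) (Fin n) A} (hx : IsQuantum q x) : QuantumMatrix q m n →ₐ[K] A :=
  RingQuot.liftAlgHom K ⟨FreeAlgebra.lift K fun p => x p.1 p.2, fun a b h => by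
    induction h with
    | row i j l h => simpa only [map_mul, map_smul, FreeAlgebra.lift_ι_apply] using hx.row i j l h
    | col i k j h => simpa only [map_mul, map_smul, FreeAlgebra.lift_ι_apply] using hx.col i k j h
    | anti i k j l h h' => simpa only [map_mul, FreeAlgebra.lift_ι_apply] using hx.anti i k j l h h'
    | diag i k j l h h' =>
      simpa only [map_mul, map_smul, map_sub, FreeAlgebra.lift_ι_apply] using hx.diag i k j l h h'⟩

theorem lift_gen {x : Matrix (Fin m) (Fin n) A} (hx : IsQuantum q x) (i : Fin m) (j : Fin n) :
    lift hx (gen q m n i j) = x i j := by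
  rw [lift, gen, RingQuot.liftAlgHom_mkAlgHom_apply, FreeAlgebra.lift_ι_apply]

theorem algHom_ext {f g : QuantumMatrix q m n →ₐ[K] A}
    (h : ∀ i j, f (gen q m n i j) = g (gen q m n i j)) : f = g :=
  RingQuot.ringQuot_ext' K f g (FreeAlgebra.hom_ext (funext fun p => h p.1 p.2))

end QuantumMatrix

theorem IsQuantum.isPartialQuantum_univ {K : Type*} [Field K] {q : K} (hq0 : q ≠ 0) {A : Type*} [Ring A]
    [Algebra K A] {m n : ℕ} {x : Matrix (Fin m) (Fin n) A} (hx : IsQuantum q x) :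
    IsPartialQuantum q Set.univ x where
  zero i j h := (h (Set.mem_univ _)).elim
  comm i j h l hlt _ _ := by
    rcases hlt with hi | ⟨rfl, hj⟩
    · rcases lt_trichotomy j l with hj | rfl | hj
      · rw [commCoeff_of_ne q hi.ne hj.ne, corrCoeff_of_lt q hi hj, one_smul, ← hx.diag i h j l hi hj]
        abel
      · rw [commCoeff_col, corrCoeff_of_col_not_lt q i h (lt_irrefl j), hx.col i h j hi, smul_smul,
          inv_mul_cancel₀ hq0, one_smul, zero_smul, sub_zero]
      · rw [commCoeff_of_ne q hi.ne hj.ne', corrCoeff_of_col_not_lt q i h hj.not_gt, one_smul, zero_smul,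
          sub_zero, hx.anti h i l j hi hj]
    · rw [commCoeff_row, corrCoeff_of_row_not_lt q j l (lt_irrefl i), hx.row i j l hj, smul_smul,
        inv_mul_cancel₀ hq0, one_smul, zero_smul, sub_zero]

theorem IsPartialQuantum.isQuantum {K : Type*} [Field K] {q : K} (hq0 : q ≠ 0) {A : Type*} [Ring A]
    [Algebra K A] {m n : ℕ} {x : Fin m → Fin n → A} (hx : IsPartialQuantum q Set.univ x) :
    IsQuantum q (x : Matrix (Fin m) (Fin n) A) where
  row i j l hj := by
    have := hx.comm i j i l (Or.inr ⟨rfl, hj⟩) trivial trivial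
    rw [commCoeff_row, corrCoeff_of_row_not_lt q j l (lt_irrefl i), zero_smul, sub_zero] at this
    rw [this, smul_smul, mul_inv_cancel₀ hq0, one_smul]
  col i h j hi := by
    have := hx.comm i j h j (Or.inl hi) trivial trivial
    rw [commCoeff_col, corrCoeff_of_col_not_lt q i h (lt_irrefl j), zero_smul, sub_zero] at this
    rw [this, smul_smul, mul_inv_cancel₀ hq0, one_smul]
  anti i h j l hi hj := by
    have := hx.comm h l i j (Or.inl hi) trivial trivial
    rwa [commCoeff_of_ne q hi.ne hj.ne', corrCoeff_of_col_not_lt q h i hj.not_gt, one_smul, zero_smul,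
      sub_zero] at this
  diag i h j l hi hj := by
    have := hx.comm i j h l (Or.inl hi) trivial trivial
    rw [commCoeff_of_ne q hi.ne hj.ne, corrCoeff_of_lt q hi hj, one_smul] at this
    rw [this, sub_sub_cancel]

/-- The algebra of quantum matrices is a domain. -/
theorem QuantumMatrix.noZeroDivisors {K : Type*} [Field K] {q : K} (hq0 : q ≠ 0) (m n : ℕ) :
    NoZeroDivisors (QuantumMatrix q m n) := by
  have h := noZeroDivisors_partial hq0 m n (m * n) le_rfl
  have hu : {p : Fin m × Fin n | (finProdFinEquiv p).val < m * n} = Set.univ := by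
    ext p
    simpa using (finProdFinEquiv p).isLt
  rw [hu] at h
  have hg := PartialQuantumMatrix.gen_isPartialQuantum q (Set.univ : Set (Fin m × Fin n))
  let f := QuantumMatrix.lift (hg.isQuantum hq0)
  let f' := PartialQuantumMatrix.lift ((gen_isQuantum q m n).isPartialQuantum_univ hq0)
  have hf : f'.comp f = AlgHom.id K _ := by
    refine algHom_ext fun i j => ?_
    have h1 : f (gen q m n i j) = PartialQuantumMatrix.gen q Set.univ i j :=
      QuantumMatrix.lift_gen _ i j
    rw [AlgHom.comp_apply, h1]
    exact PartialQuantumMatrix.lift_gen _ i j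
  have hinj : Function.Injective f :=
    Function.LeftInverse.injective (g := f') fun a => AlgHom.congr_fun hf a
  exact hinj.noZeroDivisors f (map_zero f) (map_mul f)

/-! ### Specialisation, rescaling and antidiagonal reflection -/

section Functoriality

variable {K : Type*} [Field K] {q : K} {A : Type*} [Ring A] [Algebra K A] {m n t : ℕ}

theorem map_rowMinor {B : Type*} [Ring B] [Algebra K B] (f : A →ₐ[K] B) {x : Matrix (Fin m) (Fin n) A}
    {y : Matrix (Fin m) (Fin n) B} (h : ∀ i j, f (x i j) = y i j) (a : Fin t → Fin m)
    (b : Fin t → Fin n) : f (rowMinor q x a b) = rowMinor q y a b := by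
  simp only [rowMinor, map_sum, map_smul, tupleProd, map_list_prod, List.map_ofFn, Function.comp_def, h]

theorem isQuantum_one (q : K) (n : ℕ) : IsQuantum q (1 : Matrix (Fin n) (Fin n) K) where
  row i j l h := by
    by_cases hi : i = j
    · subst hi; simp [Matrix.one_apply_ne h.ne]
    · simp [Matrix.one_apply_ne hi]
  col i k j h := by
    by_cases hi : i = j
    · subst hi; simp [Matrix.one_apply_ne h.ne']
    · simp [Matrix.one_apply_ne hi]
  anti i k j l _ _ := mul_comm _ _
  diag i k j l h h' := by
    have h0 : (1 : Matrix (Fin n) (Fin n) K) i l * (1 : Matrix (Fin n) (Fin n) K) k j = 0 := by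
      by_cases hi : i = l
      · subst hi; rw [Matrix.one_apply_ne (h'.trans h).ne', mul_zero]
      · rw [Matrix.one_apply_ne hi, zero_mul]
    rw [h0, mul_comm, sub_self, smul_zero]

theorem qdet_one (q : K) (n : ℕ) : qdet q (1 : Matrix (Fin n) (Fin n) K) = 1 := by
  have h1 : permLength (1 : Equiv.Perm (Fin n)) = 0 := tupleInv_strictMono strictMono_id
  rw [qdet, rowMinor, Finset.sum_eq_single 1]
  · rw [h1, pow_zero, one_smul, tupleProd]
    refine List.prod_eq_one fun a ha => ?_
    obtain ⟨i, rfl⟩ := List.mem_ofFn.1 ha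
    exact Matrix.one_apply_eq i
  · intro σ _ hσ
    obtain ⟨i, hi⟩ : ∃ i, σ i ≠ i := by
      by_contra! h
      exact hσ (Equiv.ext h)
    have : tupleProd (1 : Matrix (Fin n) (Fin n) K) id (id ∘ σ) = 0 := by
      rw [tupleProd, List.prod_eq_zero_iff, List.mem_ofFn]
      exact ⟨i, Matrix.one_apply_ne (Ne.symm hi)⟩
    rw [this, smul_zero]
  · simp

/-- The identity matrix over `K` satisfies the quantum relations, and specialising to it sends the
quantum determinant to `1`. -/
theorem qdet_gen_ne_zero (q : K) (n : ℕ) : qdet q (QuantumMatrix.gen q n n) ≠ 0 := fun h => by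
  have h1 := map_rowMinor (q := q) (QuantumMatrix.lift (isQuantum_one q n))
    (QuantumMatrix.lift_gen (isQuantum_one q n)) id id
  have h2 := qdet_one q n
  rw [qdet] at h h2
  rw [h, h2, map_zero] at h1
  exact zero_ne_one h1

/-- Rescaling rows by powers of the variable and columns by scalars, over polynomials. -/
noncomputable def rescale (x : Matrix (Fin m) (Fin n) A) (e : Fin m → ℕ) (v : Fin n → K) :
    Matrix (Fin m) (Fin n) (Polynomial A) :=
  fun i j => v j • (Polynomial.C (x i j) * Polynomial.X ^ e i)

theorem rescale_mul_rescale (x : Matrix (Fin m) (Fin n) A) (e : Fin m → ℕ) (v : Fin n → K) (i k : Fin m)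
    (j l : Fin n) : rescale x e v i j * rescale x e v k l =
      (v j * v l) • (Polynomial.C (x i j * x k l) * Polynomial.X ^ (e i + e k)) := by
  rw [rescale, rescale, smul_mul_smul_comm, mul_assoc, ← mul_assoc (Polynomial.X ^ e i),
    Polynomial.X_pow_mul_C, mul_assoc, ← pow_add, ← mul_assoc, ← Polynomial.C_mul]

theorem IsQuantum.rescale {x : Matrix (Fin m) (Fin n) A} (hx : IsQuantum q x) (e : Fin m → ℕ)
    (v : Fin n → K) : IsQuantum q (rescale x e v) where
  row i j l h := by
    rw [rescale_mul_rescale, rescale_mul_rescale, hx.row i j l h, ← Polynomial.smul_C, smul_mul_assoc,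
      smul_comm, mul_comm (v j)]
  col i k j h := by
    rw [rescale_mul_rescale, rescale_mul_rescale, hx.col i k j h, ← Polynomial.smul_C, smul_mul_assoc,
      smul_comm, add_comm]
  anti i k j l h h' := by
    rw [rescale_mul_rescale, rescale_mul_rescale, hx.anti i k j l h h', mul_comm (v j), add_comm]
  diag i k j l h h' := by
    rw [rescale_mul_rescale, rescale_mul_rescale, rescale_mul_rescale, mul_comm (v l), add_comm (e k),
      ← smul_sub, ← sub_mul, ← Polynomial.C_sub, hx.diag i k j l h h', ← Polynomial.smul_C,
      smul_mul_assoc, smul_comm]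

theorem tupleProd_rescale (x : Matrix (Fin m) (Fin n) A) (e : Fin m → ℕ) (v : Fin n → K) :
    ∀ {t : ℕ} (a : Fin t → Fin m) (b : Fin t → Fin n), tupleProd (rescale x e v) a b =
      (∏ p, v (b p)) • (Polynomial.C (tupleProd x a b) * Polynomial.X ^ ∑ p, e (a p))
  | 0, _, _ => by simp [tupleProd]
  | t + 1, a, b => by
    have h := tupleProd_rescale x e v (fun p => a p.succ) fun p => b p.succ
    simp only [tupleProd] at h ⊢
    rw [List.ofFn_succ, List.prod_cons, h, rescale, smul_mul_smul_comm, mul_assoc,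
      ← mul_assoc (Polynomial.X ^ e (a 0)), Polynomial.X_pow_mul_C, mul_assoc, ← pow_add, ← mul_assoc,
      ← Polynomial.C_mul, Fin.prod_univ_succ, Fin.sum_univ_succ, List.ofFn_succ, List.prod_cons]

theorem rowMinor_rescale (x : Matrix (Fin m) (Fin n) A) (e : Fin m → ℕ) (v : Fin n → K)
    (a : Fin t → Fin m) (b : Fin t → Fin n) : rowMinor q (rescale x e v) a b =
      (∏ p, v (b p)) • (Polynomial.C (rowMinor q x a b) * Polynomial.X ^ ∑ p, e (a p)) := by
  have h (σ : Equiv.Perm (Fin t)) : ∏ p, v ((b ∘ σ) p) = ∏ p, v (b p) :=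
    Equiv.prod_comp σ fun p => v (b p)
  simp only [rowMinor, tupleProd_rescale, h, map_sum, Finset.sum_mul, Finset.smul_sum,
    ← Polynomial.smul_C, smul_mul_assoc]
  exact Finset.sum_congr rfl fun σ _ => smul_comm _ _ _

/-- The reflection of a matrix along the antidiagonal, over the opposite algebra. -/
def antiTranspose (x : Matrix (Fin n) (Fin n) A) : Matrix (Fin n) (Fin n) Aᵐᵒᵖ :=
  fun i j => MulOpposite.op (x j.rev i.rev)

/-- Reversing the indices reverses their order, and the opposite multiplication compensates, so each
relation returns to itself with the roles of rows and columns exchanged. -/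
theorem IsQuantum.antiTranspose {x : Matrix (Fin n) (Fin n) A} (hx : IsQuantum q x) :
    IsQuantum q (antiTranspose x) where
  row i j l h := congrArg MulOpposite.op (hx.col l.rev j.rev i.rev (Fin.rev_lt_rev.2 h))
  col i k j h := congrArg MulOpposite.op (hx.row j.rev k.rev i.rev (Fin.rev_lt_rev.2 h))
  anti i k j l h h' := congrArg MulOpposite.op
    (hx.anti j.rev l.rev i.rev k.rev (Fin.rev_lt_rev.2 h') (Fin.rev_lt_rev.2 h)).symm
  diag i k j l h h' := by
    have h1 := hx.diag l.rev j.rev k.rev i.rev (Fin.rev_lt_rev.2 h') (Fin.rev_lt_rev.2 h)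
    rw [← hx.anti j.rev l.rev k.rev i.rev (Fin.rev_lt_rev.2 h') (Fin.rev_lt_rev.2 h)] at h1
    exact congrArg MulOpposite.op h1

theorem permLength_conj_rev (σ : Equiv.Perm (Fin t)) :
    permLength (Fin.revPerm * σ * Fin.revPerm) = permLength σ := by
  refine Finset.card_nbij' (fun p => (p.2.rev, p.1.rev)) (fun p => (p.2.rev, p.1.rev)) ?_ ?_ ?_ ?_
  · rintro ⟨i, j⟩ h
    simpa using h
  · rintro ⟨i, j⟩ h
    simpa using h
  · rintro ⟨i, j⟩ _
    simp
  · rintro ⟨i, j⟩ _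
    simp

theorem unop_tupleProd_antiTranspose (x : Matrix (Fin n) (Fin n) A) (a b : Fin t → Fin n) :
    (tupleProd (antiTranspose x) a b).unop =
      tupleProd x (fun p => (b p.rev).rev) fun p => (a p.rev).rev := by
  rw [tupleProd, MulOpposite.unop_list_prod, tupleProd, List.map_ofFn]
  congr 1
  refine List.ext_getElem (by simp) fun i h1 h2 => ?_
  have hi : i < t := by simpa using h2
  have : (⟨t - 1 - i, by omega⟩ : Fin t) = Fin.rev ⟨i, hi⟩ := Fin.ext (by simp; omega)
  simp only [List.getElem_reverse, List.getElem_ofFn, List.length_ofFn, Function.comp_apply, this]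
  rfl

/-- Term by term the reflection gives a minor of the transpose, with permutations conjugated by the
longest element. Conjugation preserves length, and transposition invariance finishes. -/
theorem IsQuantum.unop_rowMinor_antiTranspose {x : Matrix (Fin n) (Fin n) A} (hx : IsQuantum q x)
    (hq : ∀ r : ℕ, 0 < r → q ^ r ≠ 1) (hq0 : q ≠ 0) {a b : Fin t → Fin n} (ha : StrictMono a)
    (hb : StrictMono b) : (rowMinor q (_root_.antiTranspose x) a b).unop =
      rowMinor q x (fun p => (b p.rev).rev) fun p => (a p.rev).rev := by
  have hr {c : Fin t → Fin n} (hc : StrictMono c) : StrictMono fun p : Fin t => (c p.rev).rev :=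
    fun i j h => Fin.rev_lt_rev.2 (hc (Fin.rev_lt_rev.2 h))
  rw [← hx.rowMinor_transpose hq hq0 (hr hb) (hr ha)]
  simp only [rowMinor, Finset.unop_sum, MulOpposite.unop_smul, unop_tupleProd_antiTranspose]
  let e : Equiv.Perm (Fin t) ≃ Equiv.Perm (Fin t) :=
    (Equiv.mulLeft Fin.revPerm).trans (Equiv.mulRight Fin.revPerm)
  rw [← e.sum_comp]
  refine Finset.sum_congr rfl fun σ _ => ?_
  have he : e σ = Fin.revPerm * σ * Fin.revPerm := rfl
  rw [he, permLength_conj_rev, tupleProd_transpose]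
  simp [Function.comp_def]

end Functoriality

/-! ### Complementing and reversing column sets -/

section Reversal

variable {k n : ℕ}

/-- The set `w₀(Jᶜ)`, as a set of `k` columns. -/
def revComplSet (hn : k + k = n) (J : {J : Finset (Fin n) // J.card = k}) :
    {J : Finset (Fin n) // J.card = k} :=
  ⟨revCompl J.1, card_revCompl (by omega) J.2⟩

theorem mem_revCompl {I : Finset (Fin n)} {i : Fin n} : i ∈ revCompl I ↔ i.rev ∉ I := by
  simp only [revCompl, longestPerm, Finset.mem_map, Finset.mem_compl, Equiv.coe_toEmbedding,
    Fin.revPerm_apply]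
  exact ⟨fun ⟨a, h, e⟩ => by rwa [← e, Fin.rev_rev], fun h => ⟨_, h, Fin.rev_rev i⟩⟩

theorem revComplSet_revComplSet (hn : k + k = n) (J : {J : Finset (Fin n) // J.card = k}) :
    revComplSet hn (revComplSet hn J) = J :=
  Subtype.ext (Finset.ext fun i => by simp [revComplSet, mem_revCompl])

theorem enum_revComplSet (hn : k + k = n) (J : {J : Finset (Fin n) // J.card = k}) :
    (fun p => (enum (complSet hn J) p.rev).rev) = enum (revComplSet hn J) := by
  refine eq_enum_of_strictMono (fun i j h => Fin.rev_lt_rev.2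
    (enum_strictMono _ (Fin.rev_lt_rev.2 h))) _ fun i => ?_
  have h := enum_mem (complSet hn J) i.rev
  simpa [revComplSet, mem_revCompl, complSet] using h

/-- The first `k` indices. -/
def initialSet (h : k ≤ n) : {J : Finset (Fin n) // J.card = k} :=
  ⟨Finset.univ.map (Fin.castLEEmb h), by simp⟩

theorem enum_initialSet (h : k ≤ n) : Fin.castLE h = enum (initialSet h) :=
  eq_enum_of_strictMono (Fin.strictMono_castLE h) _ fun i =>
    Finset.mem_map_of_mem (Fin.castLEEmb h) (Finset.mem_univ i)

theorem revComplSet_initialSet (hn : k + k = n) (h : k ≤ n) :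
    revComplSet hn (initialSet h) = initialSet h := by
  refine Subtype.ext (Finset.ext fun i => ?_)
  have hi (j : Fin n) : j ∈ (initialSet h).1 ↔ j.val < k := by
    simp only [initialSet, Finset.mem_map, Finset.mem_univ, true_and]
    exact ⟨fun ⟨a, e⟩ => e ▸ a.2, fun hj => ⟨⟨j, hj⟩, rfl⟩⟩
  rw [hi, revComplSet, mem_revCompl, hi, Fin.val_rev]
  omega

end Reversal

/-! ### The duality map on minors of the first rows -/

section Duality

variable {K : Type*} [Field K] {q : K} {n t : ℕ}

open QuantumMatrix

/-- The composite of the antipode, up to powers of the quantum determinant, and of the reflection along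
the antidiagonal. -/
theorem exists_algHom_rowMinor (hq : ∀ r : ℕ, 0 < r → q ^ r ≠ 1) (hq0 : q ≠ 0)
    (hn : t + 1 + (t + 1) = n) (h : t + 1 ≤ n) :
    ∃ H : QuantumMatrix q n n →ₐ[K] QuantumMatrix q n n, ∀ J : {J : Finset (Fin n) // J.card = t + 1},
      H (rowMinor q (gen q n n) (enum (initialSet h)) (enum J)) =
        (complSign q hn J * (complSign q hn (initialSet h))⁻¹) • (qdet q (gen q n n) ^ t *
          rowMinor q (gen q n n) (enum (initialSet h)) (enum (revComplSet hn J))) := by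
  have := QuantumMatrix.noZeroDivisors hq0 n n
  have hx := gen_isQuantum q n n
  have hd : ∀ a, qdet q (gen q n n) * a = 0 → a = 0 := fun a ha =>
    (mul_eq_zero.1 ha).resolve_left (qdet_gen_ne_zero q n)
  have hr : (2 * t + 1) + 1 = n := by omega
  have hy := hx.opMatrix_of_mul_eq_diagonal hq0 (hx.mul_qadj hq0 hr) (hx.qadj_mul hq hq0 hr) hd
  -- Both maps reverse multiplication, so the composite is a genuine algebra homomorphism.
  refine ⟨(AlgHom.opComm (lift hx.antiTranspose)).comp (lift hy), fun J => ?_⟩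
  have h1 : lift hy (rowMinor q (gen q n n) (enum (initialSet h)) (enum J)) = _ :=
    map_rowMinor _ (lift_gen hy) _ _
  have h2 (a b : Fin (t + 1) → Fin n) : lift hx.antiTranspose (rowMinor q (gen q n n) a b) = _ :=
    map_rowMinor _ (lift_gen hx.antiTranspose) a b
  have h3 : lift hx.antiTranspose (qdet q (gen q n n)) = _ :=
    map_rowMinor _ (lift_gen hx.antiTranspose) id id
  have h4 : (lift hx.antiTranspose (qdet q (gen q n n))).unop = qdet q (gen q n n) := by
    rw [h3, hx.unop_rowMinor_antiTranspose hq hq0 strictMono_id strictMono_id]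
    simp only [id_eq, Fin.rev_rev]
    rfl
  change (lift hx.antiTranspose (lift hy _).unop).unop = _
  rw [h1, hx.unop_rowMinor_qadj hq hq0 hd hr hn, complMinor, map_mul, map_pow, map_smul, h2,
    MulOpposite.unop_mul, MulOpposite.unop_pow, h4, MulOpposite.unop_smul,
    hx.unop_rowMinor_antiTranspose hq hq0 (enum_strictMono _) (enum_strictMono _), enum_revComplSet,
    enum_revComplSet, revComplSet_initialSet, mul_smul_comm]

theorem QuantumMatrix.commute_of_commute_gen {m : ℕ} {d : QuantumMatrix q m n}
    (hd : ∀ i j, Commute d (gen q m n i j)) (a : QuantumMatrix q m n) : Commute d a := by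
  have ha : a ∈ Algebra.adjoin K (Set.range fun p : Fin m × Fin n => gen q m n p.1 p.2) := by
    have h := ringQuot_adjoin_range (QuantumMatrixRel q m n)
    exact h ▸ Algebra.mem_top
  induction ha using Algebra.adjoin_induction with
  | mem z hz => obtain ⟨p, rfl⟩ := hz; exact hd _ _
  | algebraMap r => exact (Algebra.commutes r d).symm
  | add y z _ _ hy hz => exact hy.add_right hz
  | mul y z _ _ hy hz => exact hy.mul_right hz

/-- The column rescaling makes the scalar factor independent of `J`, and the variable `X` records
the degree in the Plücker coordinates, so that the spurious central factor can be separated. -/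
theorem exists_polynomial_algHom_rowMinor (hq : ∀ r : ℕ, 0 < r → q ^ r ≠ 1) (hq0 : q ≠ 0)
    (hn : t + 1 + (t + 1) = n) (h : t + 1 ≤ n) :
    ∃ (Φ : QuantumMatrix q n n →ₐ[K] Polynomial (QuantumMatrix q n n)) (b : QuantumMatrix q n n),
      b ≠ 0 ∧ (∀ a, Commute b a) ∧ ∀ J : {J : Finset (Fin n) // J.card = t + 1},
        Φ (rowMinor q (gen q n n) (enum (initialSet h)) (enum J)) = Polynomial.C
          (rowMinor q (gen q n n) (enum (initialSet h)) (enum (revComplSet hn J))) *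
            (Polynomial.C b * Polynomial.X) := by
  have := QuantumMatrix.noZeroDivisors hq0 n n
  have hx := gen_isQuantum q n n
  have hdc : ∀ a, Commute (qdet q (gen q n n)) a := by
    have hr : (2 * t + 1) + 1 = n := by omega
    exact commute_of_commute_gen
      (commute_of_mul_eq_diagonal (hx.mul_qadj hq0 hr) (hx.qadj_mul hq hq0 hr))
  obtain ⟨H, hH⟩ := exists_algHom_rowMinor hq hq0 hn h
  set w := complSign q hn with hw
  -- Only the first row is scaled by `X`; each monomial of a maximal minor of the first `t + 1` rows
  -- uses that row once, so the minor acquires exactly one factor `X`.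
  let e : Fin n → ℕ := fun i => if i.val = 0 then 1 else 0
  have he : ∑ p, e (enum (initialSet h) p) = 1 := by
    rw [← enum_initialSet, Fin.sum_univ_succ]
    simp [e]
  have hG := hx.rescale e fun j => (-q) ^ j.val
  -- By `complSign_mul_pow`, this is the product of the column factor `(-q) ^ ∑ J` and the sign
  -- ratio from `exists_algHom_rowMinor`, for every `J`.
  set c : K := (-q) ^ (∑ p : Fin (t + 1), (t + 1 + p.val)) * (w (initialSet h))⁻¹ with hc
  have hc0 : c ≠ 0 := mul_ne_zero (pow_ne_zero _ (neg_ne_zero.2 hq0))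
    (inv_ne_zero (complSign_ne_zero hq0 hn _))
  refine ⟨(Polynomial.mapAlgHom H).comp (lift hG), c • qdet q (gen q n n) ^ t,
    smul_ne_zero hc0 (pow_ne_zero _ (qdet_gen_ne_zero q n)),
    fun a => ((hdc a).pow_left t).smul_left c, fun J => ?_⟩
  have h1 : lift hG (rowMinor q (gen q n n) (enum (initialSet h)) (enum J)) = _ :=
    map_rowMinor _ (lift_gen hG) _ _
  have h2 : (-q) ^ (∑ p, (enum J p).val) * (w J * (w (initialSet h))⁻¹) = c := by
    rw [hc, ← complSign_mul_pow q hn J, hw]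
    ring
  rw [AlgHom.comp_apply, h1, rowMinor_rescale, he, pow_one, map_smul, map_mul, Polynomial.coe_mapAlgHom,
    Polynomial.map_C, Polynomial.map_X, RingHom.coe_coe, hH, ← Polynomial.smul_C, smul_mul_assoc,
    smul_smul, Finset.prod_pow_eq_pow_sum, h2, ((hdc _).pow_left t).eq, Polynomial.C_mul, mul_assoc,
    ← Polynomial.smul_C, smul_mul_assoc, mul_smul_comm]

end Duality

theorem exists_algHom_of_surjective {R A B C : Type*} [CommSemiring R] [Semiring A] [Semiring B]
    [Semiring C] [Algebra R A] [Algebra R B] [Algebra R C] {f : A →ₐ[R] B} {g : A →ₐ[R] C}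
    (hf : Function.Surjective f) (hg : ∀ a b, f a = f b → g a = g b) :
    ∃ h : B →ₐ[R] C, ∀ a, h (f a) = g a := by
  have hs (a : A) : g (Function.surjInv hf (f a)) = g a := hg _ _ (Function.surjInv_eq hf _)
  refine ⟨AlgHom.ofLinearMap
    { toFun := fun b => g (Function.surjInv hf b)
      map_add' := fun x y => ?_
      map_smul' := fun r x => ?_ } ?_ fun x y => ?_, hs⟩
  · obtain ⟨a, rfl⟩ := hf x
    obtain ⟨b, rfl⟩ := hf y
    rw [← map_add, hs, hs, hs, map_add]
  · obtain ⟨a, rfl⟩ := hf x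
    rw [← map_smul, hs, hs, map_smul, RingHom.id_apply]
  · change g (Function.surjInv hf 1) = 1
    rw [← map_one f, hs, map_one]
  · change g (Function.surjInv hf (x * y)) = g (Function.surjInv hf x) * g (Function.surjInv hf y)
    obtain ⟨a, rfl⟩ := hf x
    obtain ⟨b, rfl⟩ := hf y
    rw [← map_mul, hs, hs, hs, map_mul]

/-! ### Descent to the quantum grassmannian -/

section Grassmannian

variable {K : Type*} [Field K] {q : K} {k n : ℕ}

open QuantumMatrix

/-- The quantum matrix of size `k × n` as the first rows of a square quantum matrix. -/
theorem exists_injective_algHom_rowMinor (q : K) (h : k ≤ n) :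
    ∃ f : QuantumMatrix q k n →ₐ[K] QuantumMatrix q n n, Function.Injective f ∧
      ∀ J : {J : Finset (Fin n) // J.card = k}, f (rowMinor q (gen q k n) id (enum J)) =
        rowMinor q (gen q n n) (enum (initialSet h)) (enum J) := by
  have hx : IsQuantum q ((gen q n n).submatrix (Fin.castLE h) id) :=
    have hg := gen_isQuantum q n n
    { row := fun i => hg.row _
      col := fun i k j hik => hg.col _ _ _ hik
      anti := fun i k j l hik => hg.anti _ _ _ _ hik
      diag := fun i k j l hik => hg.diag _ _ _ _ hik }
  -- Setting the rows beyond the first `k` to zero respects the relations, and gives a retraction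
  -- that proves injectivity.
  let y : Matrix (Fin n) (Fin n) (QuantumMatrix q k n) := fun i j =>
    if hi : i.val < k then gen q k n ⟨i, hi⟩ j else 0
  have hy : IsQuantum q y := by
    have hg := gen_isQuantum q k n
    refine ⟨fun i j l hjl => ?_, fun i k' j hik => ?_, fun i k' j l hki hjl => ?_,
      fun i k' j l hik hjl => ?_⟩
    · by_cases hi : i.val < k
      · simpa only [y, dif_pos hi] using hg.row _ j l hjl
      · simp [y, hi]
    · by_cases hi : i.val < k <;> by_cases hk : k'.val < k
      · simpa only [y, dif_pos hi, dif_pos hk] using hg.col ⟨i, hi⟩ ⟨k', hk⟩ j hik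
      all_goals simp [y, hi, hk]
    · by_cases hi : i.val < k <;> by_cases hk : k'.val < k
      · simpa only [y, dif_pos hi, dif_pos hk] using hg.anti ⟨i, hi⟩ ⟨k', hk⟩ j l hki hjl
      all_goals simp [y, hi, hk]
    · by_cases hi : i.val < k <;> by_cases hk : k'.val < k
      · simpa only [y, dif_pos hi, dif_pos hk] using hg.diag ⟨i, hi⟩ ⟨k', hk⟩ j l hik hjl
      all_goals simp [y, hi, hk]
  refine ⟨lift hx, Function.LeftInverse.injective (g := lift hy) fun a => ?_, fun J => ?_⟩
  · have : (lift hy).comp (lift hx) = AlgHom.id K _ := algHom_ext fun i j => by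
      have h1 : lift hy (gen q n n (Fin.castLE h i) j) = y (Fin.castLE h i) j := lift_gen hy _ j
      rw [AlgHom.comp_apply, lift_gen hx]
      change lift hy (gen q n n (Fin.castLE h i) j) = _
      rw [h1]
      exact dif_pos i.2
    exact AlgHom.congr_fun this a
  · have h1 : lift hx (rowMinor q (gen q k n) id (enum J)) = _ := map_rowMinor _ (lift_gen hx) _ _
    rw [h1, ← enum_initialSet]
    rfl

/-- The presentation of the quantum grassmannian by its Plücker coordinates. -/
noncomputable def pluckerPresentation (q : K) (k n : ℕ) :
    FreeAlgebra K {J : Finset (Fin n) // J.card = k} →ₐ[K] quantumGrassmannian q k n :=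
  FreeAlgebra.lift K fun J => quantumPlucker q k n J.1 J.2

theorem pluckerPresentation_surjective (q : K) (k n : ℕ) :
    Function.Surjective (pluckerPresentation q k n) := by
  have h : quantumGrassmannian q k n ≤
      ((quantumGrassmannian q k n).val.comp (pluckerPresentation q k n)).range := by
    refine Algebra.adjoin_le ?_
    rintro _ ⟨J, hJ, rfl⟩
    exact ⟨FreeAlgebra.ι K ⟨J, hJ⟩, by simp [pluckerPresentation, quantumPlucker]⟩
  intro a
  obtain ⟨P, hP⟩ := h a.2
  exact ⟨P, Subtype.ext hP⟩

/-- Complementation and reversal of the column sets. -/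
noncomputable def freeRevCompl (K : Type*) [Field K] (hn : k + k = n) :
    FreeAlgebra K {J : Finset (Fin n) // J.card = k} →ₐ[K]
      FreeAlgebra K {J : Finset (Fin n) // J.card = k} :=
  FreeAlgebra.lift K fun J => FreeAlgebra.ι K (revComplSet hn J)

theorem freeRevCompl_freeRevCompl (hn : k + k = n)
    (P : FreeAlgebra K {J : Finset (Fin n) // J.card = k}) :
    freeRevCompl K hn (freeRevCompl K hn P) = P := by
  have : (freeRevCompl K hn).comp (freeRevCompl K hn) = AlgHom.id K _ :=
    FreeAlgebra.hom_ext (funext fun J => by simp [freeRevCompl, revComplSet_revComplSet])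
  exact AlgHom.congr_fun this P

/-- The heart of the descent: relations among Plücker coordinates are stable under `J ↦ w₀(Jᶜ)`. No
homogeneous decomposition of `P` is needed, because the variable `X` separates the degrees. -/
theorem pluckerPresentation_freeRevCompl_eq_zero (hq : ∀ r : ℕ, 0 < r → q ^ r ≠ 1) (hq0 : q ≠ 0)
    (hn : k + k = n) {P : FreeAlgebra K {J : Finset (Fin n) // J.card = k}}
    (hP : pluckerPresentation q k n P = 0) :
    pluckerPresentation q k n (freeRevCompl K hn P) = 0 := by
  -- The size-zero case is separate because the determinant exponent is `k - 1`; there only the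
  -- empty column set exists.
  obtain _ | t := k
  · subst hn
    have h0 : freeRevCompl K (rfl : 0 + 0 = 0) = AlgHom.id K _ := FreeAlgebra.hom_ext (funext fun J => by
      simpa [freeRevCompl] using Subsingleton.elim _ _)
    rw [h0]
    exact hP
  have h : t + 1 ≤ n := by omega
  have := QuantumMatrix.noZeroDivisors hq0 n n
  obtain ⟨Φ, b, hb0, hb, hΦ⟩ := exists_polynomial_algHom_rowMinor hq hq0 hn h
  obtain ⟨f, hf, hfm⟩ := exists_injective_algHom_rowMinor q h
  let F := f.comp (quantumGrassmannian q (t + 1) n).val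
  have hF (J : {J : Finset (Fin n) // J.card = t + 1}) :
      F (pluckerPresentation q (t + 1) n (FreeAlgebra.ι K J)) =
        rowMinor q (gen q n n) (enum (initialSet h)) (enum J) := by
    have hid : id = Finset.univ.orderEmbOfFin (Finset.card_fin (t + 1)) :=
      Finset.orderEmbOfFin_unique _ (fun _ => Finset.mem_univ _) strictMono_id
    rw [← hfm J, pluckerPresentation, FreeAlgebra.lift_ι_apply, hid]
    rfl
  let g : FreeAlgebra K {J : Finset (Fin n) // J.card = t + 1} →ₐ[K]
      Polynomial (QuantumMatrix q n n) := FreeAlgebra.lift K fun J => Polynomial.C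
        (rowMinor q (gen q n n) (enum (initialSet h)) (enum (revComplSet hn J))) * Polynomial.X
  -- The substitution `X ↦ b X`, legitimate since `b` is central and injective since `b` is regular.
  -- It turns the homogenised relation `g P` into the image of the original relation under `Φ`.
  let E : Polynomial (QuantumMatrix q n n) →ₐ[K] Polynomial (QuantumMatrix q n n) :=
    Polynomial.eval₂AlgHom Polynomial.CAlgHom (Polynomial.C b * Polynomial.X) fun a =>
      Commute.mul_right ((hb a).symm.map Polynomial.C) (Polynomial.commute_X _).symm
  have hE : E.comp g = (Φ.comp F).comp (pluckerPresentation q (t + 1) n) := by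
    refine FreeAlgebra.hom_ext (funext fun J => ?_)
    have h1 : Φ (F (pluckerPresentation q (t + 1) n (FreeAlgebra.ι K J))) = _ :=
      (congrArg Φ (hF J)).trans (hΦ J)
    change E (g (FreeAlgebra.ι K J)) = Φ (F (pluckerPresentation q (t + 1) n (FreeAlgebra.ι K J)))
    rw [h1]
    simp [E, g]
  have hg : g P = 0 := by
    have h1 : E (g P) = 0 := by
      have h2 : E (g P) = Φ (F (pluckerPresentation q (t + 1) n P)) := AlgHom.congr_fun hE P
      rw [h2, hP, map_zero, map_zero]
    refine (Polynomial.comp_C_mul_X_eq_zero_iff (mem_nonZeroDivisors_of_ne_zero hb0)).1 ?_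
    exact h1
  -- Setting `X = 1` dehomogenises `g P = 0` to the transformed relation.
  let ev : Polynomial (QuantumMatrix q n n) →ₐ[K] QuantumMatrix q n n :=
    Polynomial.eval₂AlgHom (AlgHom.id K _) 1 fun a => Commute.one_right _
  have hev : ev.comp g = F.comp ((pluckerPresentation q (t + 1) n).comp (freeRevCompl K hn)) := by
    refine FreeAlgebra.hom_ext (funext fun J => ?_)
    have h1 := hF (revComplSet hn J)
    simp only [Function.comp_apply, AlgHom.comp_apply, freeRevCompl, FreeAlgebra.lift_ι_apply]
    rw [h1]
    simp [ev, g]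
  have h2 : F (pluckerPresentation q (t + 1) n (freeRevCompl K hn P)) = 0 := by
    have h3 : ev (g P) = _ := AlgHom.congr_fun hev P
    rw [hg, map_zero] at h3
    exact h3.symm
  exact Subtype.ext (hf (h2.trans (map_zero f).symm))

/-- The diagram endomorphism of the quantum grassmannian. -/
theorem exists_algHom_pluckerPresentation (hq : ∀ r : ℕ, 0 < r → q ^ r ≠ 1) (hq0 : q ≠ 0)
    (hn : k + k = n) :
    ∃ τ : quantumGrassmannian q k n →ₐ[K] quantumGrassmannian q k n,
      ∀ P, τ (pluckerPresentation q k n P) = pluckerPresentation q k n (freeRevCompl K hn P) := by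
  refine exists_algHom_of_surjective (g := (pluckerPresentation q k n).comp (freeRevCompl K hn))
    (pluckerPresentation_surjective q k n) fun P Q h => ?_
  have h0 : pluckerPresentation q k n (P - Q) = 0 := by rw [map_sub, h, sub_self]
  have h1 := pluckerPresentation_freeRevCompl_eq_zero hq hq0 hn h0
  rwa [map_sub, map_sub, sub_eq_zero] at h1

end Grassmannian

theorem corollary3p5 {K : Type*} [Field K] (q : K) (hq0 : q ≠ 0)
    (hq : ∀ r : ℕ, 0 < r → q ^ r ≠ 1) (k n : ℕ) (hn : n = 2 * k) :
    ∃ τ : quantumGrassmannian q k n ≃ₐ[K] quantumGrassmannian q k n,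
      ∀ (I : Finset (Fin n)) (hI : I.card = k),
        τ (quantumPlucker q k n I hI) =
          quantumPlucker q k n (revCompl I) (card_revCompl hn hI) := by
  have hn' : k + k = n := by omega
  obtain ⟨τ, hτ⟩ := exists_algHom_pluckerPresentation hq hq0 hn'
  -- Complementing and reversing is an involution on column sets, so the endomorphism is its own
  -- inverse.
  have hττ : τ.comp τ = AlgHom.id K _ := AlgHom.ext fun a => by
    obtain ⟨P, rfl⟩ := pluckerPresentation_surjective q k n a
    rw [AlgHom.comp_apply, hτ, hτ, freeRevCompl_freeRevCompl, AlgHom.id_apply]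
  refine ⟨AlgEquiv.ofAlgHom τ τ hττ hττ, fun I hI => ?_⟩
  have h := hτ (FreeAlgebra.ι K ⟨I, hI⟩)
  simp only [freeRevCompl, pluckerPresentation, FreeAlgebra.lift_ι_apply] at h
  exact h
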